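/- Let $d$ be a natural number, $M_d=M_d(\mathbb C)$, and let $\mathfrak B=\bigotimes_{i\in\mathbb Z}M_d$ be the infinite $C^*$-tensor product (a UHF algebra), with local algebras $\mathfrak B_\Lambda=\bigotimes_{i\in\Lambda}M_d$ for finite $\Lambda\subset\mathbb Z$. Let $G$ be a subgroup of the unitary group $\mathcal U(M_d)$ and put $$\mathfrak A_\Lambda=\{B\in\mathfrak B_\Lambda : g^{\otimes\Lambda}B(g^{\otimes\Lambda})^*=B \text{ for all } g\in G\},\qquad \mathfrak A=\overline{\bigcup_{n\ge1}\mathfrak A_{[-n,n]}}.$$ Let $E:M_d\otimes M_d\to M_d$ be a completely positive map and $\rho$ a state on $M_d$ such that $\rho(E(1\otimes C))=\rho(C)$ for all $C\in M_d$ and $E\big((g\otimes g)(A\otimes B)(g\otimes g)^*\big)=gE(A\otimes B)g^*$ for all $A,B\in M_d$ and $g\in G$. Let $\tilde\phi$ be the $C^*$-finitely correlated state on $\mathfrak B$ generated by $(M_d,E,\rho)$, that is, a state on $\mathfrak B$ with $$\tilde\phi(A_1\otimes\cdots\otimes A_n)=\rho\big(E(A_1\otimes E(A_2\otimes\cdots\otimes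 E(A_n\otimes 1)\cdots))\big)$$ for all $A_1,\dots,A_n\in M_d$, the tensor $A_1\otimes\cdots\otimes A_n$ being placed at any $n$ consecutive sites. Let $\phi=\tilde\phi|_{\mathfrak A}$ be the generalized (quantum) Markov chain on $\mathfrak A$ generated by $E$ and $\rho$. For a state on a finite-dimensional $C^*$-algebra isomorphic to $\bigoplus_{i=1}^kM_{d_i}$, its density matrix $D=\bigoplus_i D_i$ is taken with respect to the trace that has value $1$ on each minimal projection, and $S(D)=-\mathrm{Tr}\,D\log D$ is the von Neumann entropy. Let $\tilde D_{[1,n]}$ and $D_{[1,n]}$ be the density matrices of $\tilde\phi|_{\mathfrak B_{[1,n]}}$ and $\phi|_{\mathfrak A_{[1,n]}}$. Then the limits defining the mean entropies $$s(\tilde\phi)=\lim_{n\to\infty}\frac1n S(\tilde D_{[1,n]}),\qquad s(\phi)=\lim_{n\to\infty}\frac1n S(D_{[1,n]})$$ exist, and $$s(\phi)=s(\tilde\phi).$$ -/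

import Mathlib

open scoped ComplexOrder MatrixOrder CStarAlgebra Kronecker Topology Matrix.Norms.L2Operator
open Filter

noncomputable section

namespace QChain

/-! ### Finite-dimensional C*-algebras: states and von Neumann entropy -/

/-- A state on a unital star algebra: a positive linear functional of value `1` at the unit. -/
structure IsState {A : Type*} [Ring A] [StarRing A] [Algebra ℂ A] (φ : A →ₗ[ℂ] ℂ) : Prop where
  nonneg : ∀ a, 0 ≤ φ (star a * a)
  map_one : φ 1 = 1

/-- The density matrix of a linear functional `f` on a full matrix algebra: the unique matrix `D`
with `f X = Tr (D X)` for all `X`. -/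
def densityMatrix {m : ℕ} (f : Matrix (Fin m) (Fin m) ℂ →ₗ[ℂ] ℂ) : Matrix (Fin m) (Fin m) ℂ :=
  Matrix.of fun i j => f (Matrix.single j i 1)

theorem trace_densityMatrix_mul {m : ℕ} (f : Matrix (Fin m) (Fin m) ℂ →ₗ[ℂ] ℂ)
    (X : Matrix (Fin m) (Fin m) ℂ) : (densityMatrix f * X).trace = f X := by
  conv_rhs => rw [Matrix.matrix_eq_sum_single X]
  simp only [Matrix.trace, Matrix.diag_apply, Matrix.mul_apply, densityMatrix, Matrix.of_apply,
    map_sum]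
  rw [Finset.sum_comm]
  refine Finset.sum_congr rfl fun i _ => Finset.sum_congr rfl fun j _ => ?_
  have : Matrix.single i j (X i j) = X i j • Matrix.single i j (1 : ℂ) := by
    simp [Matrix.smul_single]
  rw [this, map_smul, smul_eq_mul, mul_comm]

/-- `Tr η(D)`, where `η x = - x log x`, for a positive matrix `D`. -/
def matrixEntropy {m : ℕ} (D : Matrix (Fin m) (Fin m) ℂ) : ℝ :=
  (cfc Real.negMulLog D).trace.re

/-- A decomposition `A ≅ M_{d_1} ⊕ ⋯ ⊕ M_{d_k}` as star algebras. -/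
structure BlockDecomposition (A : Type*) [Ring A] [StarRing A] [Algebra ℂ A] where
  k : ℕ
  dim : Fin k → ℕ
  dim_pos : ∀ i, 0 < dim i
  iso : A ≃⋆ₐ[ℂ] (∀ i, Matrix (Fin (dim i)) (Fin (dim i)) ℂ)

/-- The `i`-th block of the density matrix of `φ`. -/
def BlockDecomposition.density {A : Type*} [Ring A] [StarRing A] [Algebra ℂ A]
    (P : BlockDecomposition A) (φ : A →ₗ[ℂ] ℂ) (i : Fin P.k) :
    Matrix (Fin (P.dim i)) (Fin (P.dim i)) ℂ :=
  densityMatrix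
    { toFun := fun X => φ (P.iso.symm (Pi.single i X))
      map_add' := fun X Y => by rw [Pi.single_add, map_add, map_add]
      map_smul' := fun c X => by rw [Pi.single_smul, map_smul, map_smul, RingHom.id_apply] }

/-- The von Neumann entropy of the density matrix `D = D_1 ⊕ ⋯ ⊕ D_k` of `φ`, computed in the
decomposition `P` with the canonical trace of `M_{d_1} ⊕ ⋯ ⊕ M_{d_k}` (every minimal projection has
trace `1`). -/
def BlockDecomposition.entropy {A : Type*} [Ring A] [StarRing A] [Algebra ℂ A]
    (P : BlockDecomposition A) (φ : A →ₗ[ℂ] ℂ) : ℝ :=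
  ∑ i, matrixEntropy (P.density φ i)

/-- `s` is the mean entropy of the functional `φ` along the finite-dimensional star subalgebras
`F 1, F 2, …`: each `F n` is a direct sum of full matrix algebras, and `S(D_n) / n → s`, where
`S(D_n)` is the von Neumann entropy of `φ` restricted to `F n`. The entropy does not depend on the
decomposition of `F n` used to compute it, so that all of them are admitted. -/
def HasMeanEntropy {A : Type*} [Ring A] [StarRing A] [Algebra ℂ A] [StarModule ℂ A]
    (F : ℕ → StarSubalgebra ℂ A) (φ : A →ₗ[ℂ] ℂ) (s : ℝ) : Prop :=
  (∀ n, Nonempty (BlockDecomposition (F n))) ∧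
    ∀ P : (∀ n, BlockDecomposition (F n)),
      Tendsto (fun n : ℕ => (P n).entropy (φ ∘ₗ (F n).subtype.toAlgHom.toLinearMap) / (n : ℝ))
        atTop (𝓝 s)

/-! ### The UHF algebra `⨂_ℤ M_d` -/

/-- Configurations of the chain. -/
abbrev Config (d : ℕ) : Type := ℤ → Fin d

/-- The Hilbert space `ℓ²` of all configurations. -/
abbrev ConfigSpace (d : ℕ) : Type := lp (fun _ : Config d => ℂ) 2

/-- `(s, b) ↦ (s with b written at site i, s i)`. -/
def flipSite {d : ℕ} (i : ℤ) : Config d × Fin d ≃ Config d × Fin d where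
  toFun p := (Function.update p.1 i p.2, p.1 i)
  invFun p := (Function.update p.1 i p.2, p.1 i)
  left_inv p := by simp
  right_inv p := by simp

theorem summable_sq {d : ℕ} (ξ : ConfigSpace d) : Summable fun s => ‖ξ s‖ ^ (2 : ℕ) := by
  have := (lp.memℓp ξ).summable (by simp)
  simpa using this

theorem summable_update {d : ℕ} (i : ℤ) (ξ : ConfigSpace d) (b : Fin d) :
    Summable fun s : Config d => ‖ξ (Function.update s i b)‖ ^ (2 : ℕ) := by
  have h : Summable fun p : Config d × Fin d => ‖ξ p.1‖ ^ (2 : ℕ) := by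
    have h1 : Summable fun p : Fin d × Config d => ‖ξ p.2‖ ^ (2 : ℕ) := by
      rw [summable_prod_of_nonneg (fun _ => by positivity)]
      exact ⟨fun _ => summable_sq ξ, Summable.of_finite⟩
    exact (Equiv.prodComm (Config d) (Fin d)).summable_iff.2 h1
  have h2 := (flipSite i).summable_iff.2 h
  exact h2.comp_injective (i := fun s : Config d => (s, b)) fun s t hst => by simpa using hst

theorem memℓp_site {d : ℕ} (i : ℤ) (A : Matrix (Fin d) (Fin d) ℂ) (ξ : ConfigSpace d) :
    Memℓp (fun s : Config d => ∑ b, A (s i) b * ξ (Function.update s i b)) 2 := by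
  refine Memℓp.finsetSum _ fun b _ => ?_
  refine memℓp_gen ?_
  have hC : ∀ a, ‖A a b‖ ≤ ∑ a, ‖A a b‖ := fun a =>
    Finset.single_le_sum (f := fun a => ‖A a b‖) (fun _ _ => norm_nonneg _) (Finset.mem_univ a)
  refine Summable.of_nonneg_of_le (fun _ => by positivity) (fun s => ?_)
    ((summable_update i ξ b).mul_left ((∑ a, ‖A a b‖) ^ 2))
  simp only [ENNReal.toReal_ofNat, Real.rpow_ofNat, norm_mul, mul_pow]
  gcongr
  exact hC _

/-- The linear map on `ℓ²(Config d)` by which the matrix `A` acts on the `i`-th tensor component. -/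
def siteLin {d : ℕ} (i : ℤ) (A : Matrix (Fin d) (Fin d) ℂ) :
    ConfigSpace d →ₗ[ℂ] ConfigSpace d where
  toFun ξ := ⟨fun s => ∑ b, A (s i) b * ξ (Function.update s i b), memℓp_site i A ξ⟩
  map_add' ξ η := by
    ext s
    simp only [lp.coeFn_add, Pi.add_apply, mul_add, Finset.sum_add_distrib]
  map_smul' c ξ := by
    ext s
    simp [Finset.mul_sum, mul_left_comm]

/-- `siteLin` as a bounded operator. -/
def siteOp {d : ℕ} (i : ℤ) (A : Matrix (Fin d) (Fin d) ℂ) :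
    ConfigSpace d →L[ℂ] ConfigSpace d where
  toLinearMap := siteLin i A
  cont := by
    refine LinearMap.continuous_of_seq_closed_graph (siteLin i A) fun u x y hu hy => ?_
    have eval : ∀ s : Config d, Continuous fun ξ : ConfigSpace d => ξ s := fun s =>
      (lp.lipschitzWith_one_eval 2 s).continuous
    ext s
    refine tendsto_nhds_unique (((eval s).tendsto y).comp hy) ?_
    change Tendsto (fun n => ∑ b, A (s i) b * u n (Function.update s i b)) atTop
      (𝓝 (∑ b, A (s i) b * x (Function.update s i b)))
    exact tendsto_finsetSum _ fun b _ =>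
      (((eval (Function.update s i b)).tendsto x).comp hu).const_mul (A (s i) b)

theorem siteOp_apply {d : ℕ} (i : ℤ) (A : Matrix (Fin d) (Fin d) ℂ) (ξ : ConfigSpace d)
    (s : Config d) : siteOp i A ξ s = ∑ b, A (s i) b * ξ (Function.update s i b) := rfl

theorem siteOp_inner {d : ℕ} (i : ℤ) (A : Matrix (Fin d) (Fin d) ℂ) (ξ η : ConfigSpace d) :
    inner ℂ (siteOp i (star A) ξ) η = inner ℂ ξ (siteOp i A η) := by
  set F : Config d × Fin d → ℂ := fun p =>
    (starRingEnd ℂ) (ξ p.1) * (A (p.1 i) p.2 * η (Function.update p.1 i p.2)) with hF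
  have hb : ∀ b, Summable fun s : Config d => F (s, b) := fun b => by
    refine Summable.of_norm_bounded (((summable_sq ξ).add (summable_update i η b)).mul_left
      (∑ a, ‖A a b‖)) fun s => ?_
    have hC : ‖A (s i) b‖ ≤ ∑ a, ‖A a b‖ :=
      Finset.single_le_sum (f := fun a => ‖A a b‖) (fun _ _ => norm_nonneg _)
        (Finset.mem_univ (s i))
    simp only [hF, norm_mul, RCLike.norm_conj]
    calc _ = ‖A (s i) b‖ * (‖ξ s‖ * ‖η (Function.update s i b)‖) := by ring
      _ ≤ _ := by
        refine mul_le_mul hC ?_ (by positivity) (by positivity)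
        nlinarith [sq_nonneg (‖ξ s‖ - ‖η (Function.update s i b)‖), sq_nonneg (‖ξ s‖),
          sq_nonneg ‖η (Function.update s i b)‖]
  have hs : Summable F := by
    have h1 : Summable fun p : Fin d × Config d => F (p.2, p.1) := by
      refine Summable.of_norm ?_
      rw [summable_prod_of_nonneg (fun _ => norm_nonneg _)]
      exact ⟨fun b => (hb b).norm, Summable.of_finite⟩
    exact (Equiv.prodComm (Fin d) (Config d)).symm.summable_iff.2 h1
  have hl : (inner ℂ (siteOp i (star A) ξ) η : ℂ) = ∑' p, F (flipSite i p) := by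
    have hs' : Summable fun p => F (flipSite i p) :=
      hs.comp_injective (flipSite i).injective
    rw [hs'.tsum_prod, lp.inner_eq_tsum]
    refine tsum_congr fun s => ?_
    rw [tsum_fintype, siteOp_apply]
    simp only [RCLike.inner_apply, map_sum, map_mul, Matrix.star_apply, Finset.mul_sum]
    refine Finset.sum_congr rfl fun b _ => ?_
    simp [hF, flipSite]
    ring
  have hr : (inner ℂ ξ (siteOp i A η) : ℂ) = ∑' p, F p := by
    rw [hs.tsum_prod, lp.inner_eq_tsum]
    refine tsum_congr fun s => ?_
    rw [tsum_fintype, siteOp_apply]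
    simp only [RCLike.inner_apply, Finset.sum_mul, hF]
    refine Finset.sum_congr rfl fun b _ => by ring
  rw [hl, hr, (flipSite i).tsum_eq]

/-- The canonical action of `M_d` at site `i`, as a star homomorphism. -/
def siteHom {d : ℕ} (i : ℤ) :
    Matrix (Fin d) (Fin d) ℂ →⋆ₐ[ℂ] (ConfigSpace d →L[ℂ] ConfigSpace d) where
  toFun A := siteOp i A
  map_one' := by
    ext ξ s
    simp [siteOp_apply, Matrix.one_apply]
  map_mul' A B := by
    ext ξ s
    simp only [siteOp_apply, Matrix.mul_apply, mul_apply_eq_comp, Finset.sum_mul,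
      Function.update_self, Function.update_idem, Finset.mul_sum]
    rw [Finset.sum_comm]
    simp [mul_assoc]
  map_zero' := by
    ext ξ s
    simp [siteOp_apply]
  map_add' A B := by
    ext ξ s
    simp [siteOp_apply, add_mul, Finset.sum_add_distrib]
  commutes' c := by
    ext ξ s
    simp [siteOp_apply, Algebra.algebraMap_eq_smul_one, Matrix.one_apply]
  map_star' A := by
    rw [ContinuousLinearMap.star_eq_adjoint, ContinuousLinearMap.eq_adjoint_iff]
    exact siteOp_inner i A

/-- The UHF algebra `⨂_{i ∈ ℤ} M_d`: the C*-algebra generated by commuting copies of `M_d`, one for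
each site, acting on `ℓ²(Config d)`. -/
def UHF (d : ℕ) : StarSubalgebra ℂ (ConfigSpace d →L[ℂ] ConfigSpace d) :=
  (StarAlgebra.adjoin ℂ
    (⋃ i : ℤ, Set.range (siteHom i : Matrix (Fin d) (Fin d) ℂ → _))).topologicalClosure

/-- The canonical embedding of `M_d` as the `i`-th component of the UHF algebra. -/
def site {d : ℕ} (i : ℤ) : Matrix (Fin d) (Fin d) ℂ →⋆ₐ[ℂ] UHF d :=
  (siteHom i).codRestrict (UHF d) fun A => StarSubalgebra.le_topologicalClosure _
    (StarAlgebra.subset_adjoin ℂ _ (Set.mem_iUnion.2 ⟨i, A, rfl⟩))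

theorem site_commute {d : ℕ} {i j : ℤ} (hij : i ≠ j) (A B : Matrix (Fin d) (Fin d) ℂ) :
    Commute (site i A) (site j B) := by
  apply Subtype.ext
  change siteOp i A * siteOp j B = siteOp j B * siteOp i A
  ext ξ s
  simp only [siteOp_apply, mul_apply_eq_comp, Finset.mul_sum]
  rw [Finset.sum_comm]
  refine Finset.sum_congr rfl fun a _ => Finset.sum_congr rfl fun b _ => ?_
  rw [Function.update_of_ne hij.symm, Function.update_of_ne hij, Function.update_comm hij]
  ring

/-- The local algebra `⨂_{i ∈ Λ} M_d` of a finite set `Λ` of sites. -/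
def localAlg (d : ℕ) (Λ : Finset ℤ) : StarSubalgebra ℂ (UHF d) :=
  StarAlgebra.adjoin ℂ (⋃ i ∈ Λ, Set.range (site i : Matrix (Fin d) (Fin d) ℂ → _))

/-- The unitary `⨂_{i ∈ Λ} g` of the local algebra of `Λ`. -/
def tensorPower {d : ℕ} (g : Matrix.unitaryGroup (Fin d) ℂ) (Λ : Finset ℤ) : unitary (UHF d) :=
  Λ.noncommProd (fun i => (⟨site i g, Unitary.map_mem (site i) g.2⟩ : unitary (UHF d))) fun _ _ _ _ hij =>
    Subtype.ext (site_commute hij _ _)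

/-- The fixed points in the local algebra of `Λ` under the product action `Ad (⨂_{i ∈ Λ} g)` of the
elements `g` of `G`. -/
def invariantAlg {d : ℕ} (G : Subgroup (Matrix.unitaryGroup (Fin d) ℂ)) (Λ : Finset ℤ) :
    StarSubalgebra ℂ (UHF d) :=
  localAlg d Λ ⊓ ⨅ g ∈ G, StarAlgHom.equalizer
    (Unitary.conjStarAlgAut ℂ (UHF d) (tensorPower g Λ)).toStarAlgHom
    (StarAlgHom.id ℂ (UHF d))

/-- The gauge-invariant C*-algebra: the closure of the union of the increasing sequence of the
fixed point algebras of the intervals `[-n, n]`. -/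
def gaugeAlg {d : ℕ} (G : Subgroup (Matrix.unitaryGroup (Fin d) ℂ)) : StarSubalgebra ℂ (UHF d) :=
  (⨆ n : ℕ, invariantAlg G (Finset.Icc (-(n : ℤ)) n)).topologicalClosure

theorem invariantAlg_mono {d : ℕ} (G : Subgroup (Matrix.unitaryGroup (Fin d) ℂ))
    {Λ Λ' : Finset ℤ} (h : Λ ⊆ Λ') : invariantAlg G Λ ≤ invariantAlg G Λ' := by
  intro x hx
  simp only [invariantAlg, StarSubalgebra.mem_inf, StarSubalgebra.mem_iInf] at hx ⊢
  refine ⟨StarAlgebra.adjoin_mono (Set.biUnion_subset_biUnion_left h) hx.1, fun g hg => ?_⟩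
  have hu : tensorPower g Λ' = tensorPower g (Λ' \ Λ) * tensorPower g Λ := by
    unfold tensorPower
    rw [← Finset.noncommProd_union_of_disjoint Finset.sdiff_disjoint]
    · congr 1
      exact (Finset.sdiff_union_of_subset h).symm
    · exact fun _ _ _ _ hij => Subtype.ext (site_commute hij _ _)
  have h1 : localAlg d Λ ≤ StarAlgHom.equalizer
      (Unitary.conjStarAlgAut ℂ (UHF d) (tensorPower g (Λ' \ Λ))).toStarAlgHom
      (StarAlgHom.id ℂ (UHF d)) := by
    refine StarAlgHom.adjoin_le_equalizer _ _ fun y hy => ?_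
    simp only [Set.mem_iUnion] at hy
    obtain ⟨i, hi, A, rfl⟩ := hy
    have hc : Commute (tensorPower g (Λ' \ Λ) : UHF d) (site i A) := by
      refine Finset.noncommProd_induction (Λ' \ Λ) _ _
        (fun u : unitary (UHF d) => Commute (u : UHF d) (site i A)) ?_ ?_ ?_
      · intro a b ha hb
        exact Commute.mul_left ha hb
      · exact Commute.one_left _
      · intro j hj
        refine site_commute ?_ _ _
        rintro rfl
        exact (Finset.mem_sdiff.1 hj).2 hi
    change (tensorPower g (Λ' \ Λ) : UHF d) * site i A *
      star (tensorPower g (Λ' \ Λ) : UHF d) = site i A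
    rw [hc.eq, mul_assoc, Unitary.mul_star_self_of_mem (tensorPower g (Λ' \ Λ)).2, mul_one]
  have h2 := hx.2 g hg
  have h3 := h1 hx.1
  rw [StarAlgHom.mem_equalizer] at h2 h3 ⊢
  change Unitary.conjStarAlgAut ℂ (UHF d) (tensorPower g Λ') x = x
  change Unitary.conjStarAlgAut ℂ (UHF d) (tensorPower g Λ) x = x at h2
  change Unitary.conjStarAlgAut ℂ (UHF d) (tensorPower g (Λ' \ Λ)) x = x at h3
  rw [hu, map_mul]
  change Unitary.conjStarAlgAut ℂ (UHF d) (tensorPower g (Λ' \ Λ))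
    (Unitary.conjStarAlgAut ℂ (UHF d) (tensorPower g Λ) x) = x
  rw [h2, h3]

theorem invariantAlg_le_gaugeAlg {d : ℕ} (G : Subgroup (Matrix.unitaryGroup (Fin d) ℂ)) (n : ℕ) :
    invariantAlg G (Finset.Icc 1 (n : ℤ)) ≤ gaugeAlg G :=
  (invariantAlg_mono G (Finset.Icc_subset_Icc_left (by omega))).trans
    ((le_iSup (fun n : ℕ => invariantAlg G (Finset.Icc (-(n : ℤ)) n)) n).trans
      (StarSubalgebra.le_topologicalClosure _))

/-- The fixed point algebra of the interval `[1, n]`, as a subalgebra of the gauge-invariant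
C*-algebra that contains it. -/
def gaugeLocalAlg {d : ℕ} (G : Subgroup (Matrix.unitaryGroup (Fin d) ℂ)) (n : ℕ) :
    StarSubalgebra ℂ (gaugeAlg G) :=
  (invariantAlg G (Finset.Icc 1 (n : ℤ))).comap (gaugeAlg G).subtype

theorem map_gaugeLocalAlg {d : ℕ} (G : Subgroup (Matrix.unitaryGroup (Fin d) ℂ)) (n : ℕ) :
    (gaugeLocalAlg G n).map (gaugeAlg G).subtype = invariantAlg G (Finset.Icc 1 (n : ℤ)) := by
  ext x
  constructor
  · rintro ⟨y, hy, rfl⟩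
    exact hy
  · exact fun hx => ⟨⟨x, invariantAlg_le_gaugeAlg G n hx⟩, hx, rfl⟩

/-! ### Finitely correlated states and generalized Markov chains -/

/-- The elementary tensor `A_1 ⊗ ⋯ ⊗ A_n` placed at the sites `k, k + 1, …, k + n - 1`. -/
def elemTensor {d : ℕ} : ℤ → List (Matrix (Fin d) (Fin d) ℂ) → UHF d
  | _, [] => 1
  | k, A :: l => site k A * elemTensor (k + 1) l

/-- `E (A_1 ⊗ E (A_2 ⊗ ⋯ ⊗ E (A_n ⊗ 1) ⋯ ))`. The tensor product `M_d ⊗ M_d` is the algebra of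
matrices indexed by `Fin d × Fin d`, with `A ⊗ B` the Kronecker product. -/
def iterate {d : ℕ}
    (E : Matrix (Fin d × Fin d) (Fin d × Fin d) ℂ →CP Matrix (Fin d) (Fin d) ℂ) :
    List (Matrix (Fin d) (Fin d) ℂ) → Matrix (Fin d) (Fin d) ℂ
  | [] => 1
  | A :: l => E (A ⊗ₖ iterate E l)

/-- `φ` is the C*-finitely correlated state on the UHF algebra generated by the triple
`(M_d, E, ρ)`. -/
structure IsFinitelyCorrelated {d : ℕ}
    (E : Matrix (Fin d × Fin d) (Fin d × Fin d) ℂ →CP Matrix (Fin d) (Fin d) ℂ)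
    (ρ : Matrix (Fin d) (Fin d) ℂ →ₗ[ℂ] ℂ) (φ : UHF d →ₗ[ℂ] ℂ) : Prop where
  isState : IsState φ
  isState_rho : IsState ρ
  invariant : ∀ C : Matrix (Fin d) (Fin d) ℂ,
    ρ (E ((1 : Matrix (Fin d) (Fin d) ℂ) ⊗ₖ C)) = ρ C
  apply_elemTensor : ∀ (k : ℤ) (l : List (Matrix (Fin d) (Fin d) ℂ)),
    φ (elemTensor k l) = ρ (iterate E l)

/-- The covariance condition `E ((g ⊗ g) (A ⊗ B) (g ⊗ g)*) = g E (A ⊗ B) g*` for `g ∈ G`. -/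
def IsCovariant {d : ℕ} (G : Subgroup (Matrix.unitaryGroup (Fin d) ℂ))
    (E : Matrix (Fin d × Fin d) (Fin d × Fin d) ℂ →CP Matrix (Fin d) (Fin d) ℂ) : Prop :=
  ∀ g ∈ G, ∀ A B : Matrix (Fin d) (Fin d) ℂ,
    E (((g : Matrix (Fin d) (Fin d) ℂ) ⊗ₖ (g : Matrix (Fin d) (Fin d) ℂ)) * (A ⊗ₖ B) *
        star ((g : Matrix (Fin d) (Fin d) ℂ) ⊗ₖ (g : Matrix (Fin d) (Fin d) ℂ))) =
      (g : Matrix (Fin d) (Fin d) ℂ) * E (A ⊗ₖ B) * star (g : Matrix (Fin d) (Fin d) ℂ)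

/-- `φ` is the generalized Markov chain on the gauge-invariant C*-algebra of `G` generated by `E`
and `ρ`: the map `E` is `G`-covariant and `φ` is the restriction of the C*-finitely correlated state
`φt` on the UHF algebra generated by `(M_d, E, ρ)`. -/
structure IsGeneralizedMarkovChain {d : ℕ} (G : Subgroup (Matrix.unitaryGroup (Fin d) ℂ))
    (E : Matrix (Fin d × Fin d) (Fin d × Fin d) ℂ →CP Matrix (Fin d) (Fin d) ℂ)
    (ρ : Matrix (Fin d) (Fin d) ℂ →ₗ[ℂ] ℂ) (φt : UHF d →ₗ[ℂ] ℂ) (φ : gaugeAlg G →ₗ[ℂ] ℂ) :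
    Prop where
  isFinitelyCorrelated : IsFinitelyCorrelated E ρ φt
  isCovariant : IsCovariant G E
  eq_restrict : ∀ a : gaugeAlg G, φ a = φt a

end QChain

end

open scoped ComplexOrder MatrixOrder CStarAlgebra Kronecker Topology Matrix.Norms.L2Operator
open Filter

noncomputable section

namespace QChain

open Matrix

/-! ### Classical entropy inequalities -/

/-! Passing to a subalgebra changes the entropy by no more than the logarithm of the number of
irreducible summands. Restrict a state with density `D` on a matrix algebra to a subalgebra,
represented as `⨁ Y_i ⊗ 1` with multiplicity spaces indexed by `J_i`. The restricted density has as
blocks the partial traces of `D` over the multiplicity spaces, and its entropy differs from that of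
`D` by at most `log ∑ |J_i|` (`abs_entropy_sub_spectralEntropy_le`). The projections onto the
irreducible summands are independent elements of the commutant, so `∑ |J_i|` is at most the
dimension of the commutant (`card_le_finrank_centralizer`).

The fixed point algebra of `n` sites contains all permutations of the tensor components, since these
commute with `g ⊗ ⋯ ⊗ g`. A matrix commuting with all permutations is determined by its values on
the orbits of pairs of configurations, so the commutant has dimension at most `(n+1)^(d²)`
(`finrank_centralizer_le`). The two local entropies therefore differ by at most `d² log (n+1)`,
which is negligible after division by `n`.

It remains to find the limit for the full local algebras. The densities do not depend on the
position of the interval (`IsFinitelyCorrelated.stateMatrix_eq`) and entropy is subadditive over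
adjacent intervals (`spectralEntropy_stateMatrix_add_le`), so Fekete's lemma applies.

All matrix inequalities reduce to one estimate, `spectralEntropy_mul_conjTranspose_le`, and to `log
t ≤ t - 1`. -/

open Real in
-- Gibbs' inequality against the uniform weights `x / K`, where `x` is the total mass: apply `log t
-- ≤ t - 1` at `t = x / (K p_j)` and sum. This is the only source of the `log K` in the entropy
-- comparison.
theorem sum_negMulLog_le_add_log_card {J : Type*} [Fintype J] (p : J → ℝ) (hp : ∀ j, 0 ≤ p j)
    {K : ℝ} (hK : 1 ≤ K) (hJ : (Fintype.card J : ℝ) ≤ K) :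
    ∑ j, negMulLog (p j) ≤ negMulLog (∑ j, p j) + (∑ j, p j) * log K := by
  set x := ∑ j, p j with hx
  have hx0 : 0 ≤ x := Finset.sum_nonneg fun j _ => hp j
  have key : ∀ j, negMulLog (p j) + p j * log x - p j * log K ≤ x / K - p j := by
    intro j
    rcases (hp j).eq_or_lt with h0 | h0
    · rw [← h0]
      simp only [negMulLog_zero, zero_mul, add_zero, sub_zero]
      positivity
    · have hx1 : 0 < x := h0.trans_le (Finset.single_le_sum (fun j _ => hp j) (Finset.mem_univ j))
      have hK0 : 0 < K := by linarith
      have h := log_le_sub_one_of_pos (show 0 < x / K / p j by positivity)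
      rw [log_div (by positivity) h0.ne', log_div hx1.ne' hK0.ne'] at h
      have h2 := mul_le_mul_of_nonneg_left h h0.le
      have h3 : p j * (x / K / p j - 1) = x / K - p j := by field_simp
      rw [h3] at h2
      simp only [negMulLog]
      linarith
  have hs := Finset.sum_le_sum fun j (_ : j ∈ Finset.univ) => key j
  simp only [Finset.sum_sub_distrib, Finset.sum_add_distrib, ← Finset.sum_mul, ← hx,
    Finset.sum_const, Finset.card_univ, nsmul_eq_mul] at hs
  have : (Fintype.card J : ℝ) * (x / K) ≤ x := by
    rw [mul_div_assoc', div_le_iff₀ (by linarith), mul_comm]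
    exact mul_le_mul_of_nonneg_left hJ hx0
  simp only [negMulLog] at hs ⊢
  linarith

open Real in
-- Subadditivity of Shannon entropy: Gibbs' inequality against the product of the two marginals.
theorem sum_negMulLog_le_marginals {I J : Type*} [Fintype I] [Fintype J] (p : I → J → ℝ)
    (hp : ∀ i j, 0 ≤ p i j) (h1 : ∑ i, ∑ j, p i j = 1) :
    ∑ i, ∑ j, negMulLog (p i j) ≤
      ∑ i, negMulLog (∑ j, p i j) + ∑ j, negMulLog (∑ i, p i j) := by
  set a : I → ℝ := fun i => ∑ j, p i j with ha
  set b : J → ℝ := fun j => ∑ i, p i j with hb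
  have ha0 : ∀ i, 0 ≤ a i := fun i => Finset.sum_nonneg fun j _ => hp i j
  have hb0 : ∀ j, 0 ≤ b j := fun j => Finset.sum_nonneg fun i _ => hp i j
  have key : ∀ i j, negMulLog (p i j) + p i j * log (a i) + p i j * log (b j)
      ≤ a i * b j - p i j := by
    intro i j
    rcases (hp i j).eq_or_lt with h0 | h0
    · rw [← h0]
      simp only [negMulLog_zero, zero_mul, add_zero, sub_zero]
      exact mul_nonneg (ha0 i) (hb0 j)
    · have h2 : 0 < a i :=
        h0.trans_le (Finset.single_le_sum (fun j _ => hp i j) (Finset.mem_univ j))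
      have h3 : 0 < b j :=
        h0.trans_le (Finset.single_le_sum (f := fun i => p i j) (fun i _ => hp i j)
          (Finset.mem_univ i))
      have h := log_le_sub_one_of_pos (show 0 < a i * b j / p i j by positivity)
      rw [log_div (by positivity) h0.ne', log_mul h2.ne' h3.ne'] at h
      have h4 := mul_le_mul_of_nonneg_left h h0.le
      have h5 : p i j * (a i * b j / p i j - 1) = a i * b j - p i j := by field_simp
      rw [h5] at h4
      simp only [negMulLog]
      linarith
  have hs := Finset.sum_le_sum fun i (_ : i ∈ Finset.univ) =>
    Finset.sum_le_sum fun j (_ : j ∈ Finset.univ) => key i j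
  have e1 : ∑ i, ∑ j, p i j * log (a i) = ∑ i, a i * log (a i) :=
    Finset.sum_congr rfl fun i _ => (Finset.sum_mul _ _ _).symm
  have e2 : ∑ i, ∑ j, p i j * log (b j) = ∑ j, b j * log (b j) := by
    rw [Finset.sum_comm]
    exact Finset.sum_congr rfl fun i _ => (Finset.sum_mul _ _ _).symm
  have e3 : ∑ i, ∑ j, a i * b j = 1 := by
    have hb1 : ∑ j, b j = 1 := by rw [← h1, Finset.sum_comm]
    simp only [← Finset.mul_sum, hb1, mul_one]
    exact h1
  simp only [Finset.sum_sub_distrib, Finset.sum_add_distrib, e1, e2, e3] at hs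
  simp only [negMulLog, neg_mul, Finset.sum_neg_distrib] at hs ⊢
  linarith

/-! ### Entropy of a positive matrix -/

section Entropy

variable {X S : Type*} [Fintype X] [DecidableEq X] [Fintype S]

/-- `Tr η(D)` for a matrix with an arbitrary finite index set. -/
def spectralEntropy (D : Matrix X X ℂ) : ℝ := (cfc Real.negMulLog D).trace.re

theorem spectralEntropy_eq_sum {D : Matrix X X ℂ} (hD : D.IsHermitian) :
    spectralEntropy D = ∑ k, Real.negMulLog (hD.eigenvalues k) := by
  rw [spectralEntropy, hD.cfc_eq, Matrix.IsHermitian.cfc, Unitary.conjStarAlgAut_apply,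
    Matrix.trace_mul_comm, ← mul_assoc]
  simp [Matrix.trace]

theorem eigenvectorUnitary_conj {D : Matrix X X ℂ} (hD : D.IsHermitian) :
    (hD.eigenvectorUnitary : Matrix X X ℂ)ᴴ * D * (hD.eigenvectorUnitary : Matrix X X ℂ) =
      diagonal fun k => (hD.eigenvalues k : ℂ) := by
  have := hD.conjStarAlgAut_star_eigenvectorUnitary
  simpa [Unitary.conjStarAlgAut_apply, Function.comp_def, star_eq_conjTranspose] using this

theorem eigenvectorUnitary_mul_conjTranspose {D : Matrix X X ℂ} (hD : D.IsHermitian) :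
    (hD.eigenvectorUnitary : Matrix X X ℂ) * (hD.eigenvectorUnitary : Matrix X X ℂ)ᴴ = 1 :=
  mem_unitaryGroup_iff.1 (SetLike.coe_mem hD.eigenvectorUnitary)

/-- If `D = ∑ |x_s⟩⟨x_s|`, then the entropy of `D` is at most that of the weights `‖x_s‖²`. -/
theorem spectralEntropy_mul_conjTranspose_le (W : Matrix X S ℂ) :
    spectralEntropy (W * Wᴴ) ≤ ∑ s, Real.negMulLog ((Wᴴ * W) s s).re := by
  have hD : (W * Wᴴ).IsHermitian := isHermitian_mul_conjTranspose_self W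
  rw [spectralEntropy_eq_sum hD]
  set l := hD.eigenvalues
  set U : Matrix X X ℂ := (hD.eigenvectorUnitary).1
  have hl : ∀ k, 0 ≤ l k := (posSemidef_self_mul_conjTranspose W).eigenvalues_nonneg
  set Z : Matrix X S ℂ := Uᴴ * W with hZ
  have hZZ : Z * Zᴴ = diagonal fun k => (l k : ℂ) := by
    rw [← eigenvectorUnitary_conj hD, hZ, conjTranspose_mul, conjTranspose_conjTranspose]
    simp only [Matrix.mul_assoc]
    rfl
  have hWW : Wᴴ * W = Zᴴ * Z := by
    rw [hZ, conjTranspose_mul, conjTranspose_conjTranspose, Matrix.mul_assoc,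
      ← Matrix.mul_assoc U, eigenvectorUnitary_mul_conjTranspose hD, Matrix.one_mul]
  set c : X → S → ℝ := fun k s => Complex.normSq (Z k s)
  have hc0 : ∀ k s, 0 ≤ c k s := fun k s => Complex.normSq_nonneg _
  have hrow : ∀ k, ∑ s, c k s = l k := by
    intro k
    have := congrFun (congrFun hZZ k) k
    rw [mul_apply, diagonal_apply_eq] at this
    apply Complex.ofReal_injective
    rw [← this]
    push_cast
    exact Finset.sum_congr rfl fun s _ => by
      rw [conjTranspose_apply, Complex.star_def, Complex.mul_conj]
  -- The array `c = |Z|²` has the eigenvalues `l` as row sums and the weights `x` as column sums.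
  set x : S → ℝ := fun s => ((Wᴴ * W) s s).re with hx
  have hcol : ∀ s, ∑ k, c k s = x s := by
    intro s
    rw [hx]
    simp only
    rw [hWW, mul_apply, Complex.re_sum]
    refine Finset.sum_congr rfl fun k _ => ?_
    rw [conjTranspose_apply, Complex.star_def, mul_comm, Complex.mul_conj, Complex.ofReal_re]
  -- Bessel's inequality: the rows of `Z` are orthogonal with squared norms `l k`. Rows with `l k =
  -- 0` vanish and contribute `0`, as division by zero gives `0`.
  have hbessel : ∀ s, ∑ k, c k s / l k ≤ 1 := by
    intro s
    set y : X → ℂ := fun k => Z k s / l k with hy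
    set C : ℝ := ∑ k, c k s / l k with hC
    -- Up to conjugation, `z` is the projection of the basis vector at `s` onto the row space. Both
    -- `z s` and `‖z‖²` equal `C`, so `C² ≤ C`.
    set z : S → ℂ := fun t => ∑ k, (starRingEnd ℂ) (Z k t) * y k with hz
    have hzs : z s = C := by
      rw [hz, hC]
      simp only [hy]
      push_cast
      refine Finset.sum_congr rfl fun k _ => ?_
      rw [mul_div_assoc', mul_comm, Complex.mul_conj]
    have hzz : ∑ t, Complex.normSq (z t) = C := by
      apply Complex.ofReal_injective
      have e : ∀ t, (Complex.normSq (z t) : ℂ) =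
          ∑ k, ∑ k', (starRingEnd ℂ) (y k) * y k' * (Z k t * (starRingEnd ℂ) (Z k' t)) := by
        intro t
        rw [Complex.normSq_eq_conj_mul_self, hz]
        simp only [map_sum, Finset.sum_mul_sum, map_mul, Complex.conj_conj]
        exact Finset.sum_congr rfl fun k _ => Finset.sum_congr rfl fun k' _ => by ring
      push_cast
      simp only [e]
      rw [Finset.sum_comm]
      rw [hC]
      push_cast
      refine Finset.sum_congr rfl fun k _ => ?_
      rw [Finset.sum_comm]
      have e2 : ∀ k', ∑ t, (starRingEnd ℂ) (y k) * y k' * (Z k t * (starRingEnd ℂ) (Z k' t)) =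
          if k = k' then (starRingEnd ℂ) (y k) * y k' * l k else 0 := by
        intro k'
        rw [← Finset.mul_sum]
        have := congrFun (congrFun hZZ k) k'
        rw [mul_apply, diagonal_apply] at this
        simp only [conjTranspose_apply, Complex.star_def] at this
        rw [this]
        simp
      simp only [e2, Finset.sum_ite_eq, Finset.mem_univ, if_true]
      rw [← Complex.normSq_eq_conj_mul_self]
      simp only [hy, Complex.normSq_div, Complex.normSq_ofReal]
      rcases eq_or_ne (l k) 0 with h0 | h0
      · simp [h0]
      · have : (l k : ℂ) ≠ 0 := by exact_mod_cast h0
        push_cast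
        field_simp
        rfl
    have h1 : Complex.normSq (z s) ≤ C :=
      hzz ▸ Finset.single_le_sum (f := fun t => Complex.normSq (z t))
        (fun t _ => Complex.normSq_nonneg _) (Finset.mem_univ s)
    rw [hzs, Complex.normSq_ofReal] at h1
    by_contra! h2
    nlinarith
  -- Use `log t ≤ t - 1` at `t = x s / l k`, weighted by `c k s`. After summation over `k`,
  -- `hbessel` makes the right side at most `x s - x s = 0`.
  have key : ∀ s, ∑ k, c k s * Real.log (x s) ≤ ∑ k, c k s * Real.log (l k) := by
    intro s
    have hx0 : 0 ≤ x s := hcol s ▸ Finset.sum_nonneg fun k _ => hc0 k s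
    have h : ∀ k, c k s * Real.log (x s) - c k s * Real.log (l k) ≤
        x s * (c k s / l k) - c k s := by
      intro k
      rcases (hc0 k s).eq_or_lt with h0 | h0
      · simp [← h0]
      · have h1 : 0 < x s := by
          rw [← hcol s]
          exact h0.trans_le (Finset.single_le_sum (f := fun k => c k s) (fun k _ => hc0 k s)
            (Finset.mem_univ k))
        have h2 : 0 < l k := by
          rw [← hrow k]
          exact h0.trans_le (Finset.single_le_sum (fun s _ => hc0 k s) (Finset.mem_univ s))
        have h := Real.log_le_sub_one_of_pos (show 0 < x s / l k by positivity)
        rw [Real.log_div h1.ne' h2.ne'] at h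
        have h3 := mul_le_mul_of_nonneg_left h h0.le
        calc _ = c k s * (Real.log (x s) - Real.log (l k)) := by ring
          _ ≤ _ := h3
          _ = _ := by field_simp
    have hs := Finset.sum_le_sum fun k (_ : k ∈ Finset.univ) => h k
    rw [Finset.sum_sub_distrib, Finset.sum_sub_distrib, ← Finset.mul_sum, hcol] at hs
    have := mul_le_mul_of_nonneg_left (hbessel s) hx0
    linarith
  have hs := Finset.sum_le_sum fun s (_ : s ∈ Finset.univ) => key s
  rw [Finset.sum_comm (f := fun s k => c k s * Real.log (l k))] at hs
  simp only [← Finset.sum_mul, hcol, hrow] at hs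
  simp only [Real.negMulLog, neg_mul, Finset.sum_neg_distrib]
  exact neg_le_neg hs

/-- Schur's inequality, for a Parseval frame `V`. -/
theorem spectralEntropy_le_of_mul_conjTranspose_eq_one {D : Matrix X X ℂ} (hD : D.PosSemidef)
    (V : Matrix X S ℂ) (hV : V * Vᴴ = 1) :
    spectralEntropy D ≤ ∑ s, Real.negMulLog ((Vᴴ * D * V) s s).re := by
  set R := CFC.sqrt D
  have hR : Rᴴ = R := (CFC.sqrt_nonneg D).isSelfAdjoint
  have hRR : R * R = D := CFC.sqrt_mul_sqrt_self D hD.nonneg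
  -- The columns of `√D V` decompose `D`, because `√D V Vᴴ √D = D`.
  have h := spectralEntropy_mul_conjTranspose_le (R * V)
  rwa [conjTranspose_mul, hR, Matrix.mul_assoc R, ← Matrix.mul_assoc V, hV, Matrix.one_mul, hRR,
    Matrix.mul_assoc Vᴴ, ← Matrix.mul_assoc R, hRR, ← Matrix.mul_assoc] at h

theorem spectralEntropy_nonneg {D : Matrix X X ℂ} (hD : D.PosSemidef) (h1 : D.trace = 1) :
    0 ≤ spectralEntropy D := by
  rw [spectralEntropy_eq_sum hD.isHermitian]
  have hs : ∑ k, hD.isHermitian.eigenvalues k = 1 := by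
    have := hD.isHermitian.trace_eq_sum_eigenvalues
    rw [h1] at this
    exact Complex.ofReal_injective (by push_cast; exact this.symm)
  exact Finset.sum_nonneg fun k _ => Real.negMulLog_nonneg (hD.eigenvalues_nonneg k)
    (hs ▸ Finset.single_le_sum (fun k _ => hD.eigenvalues_nonneg k) (Finset.mem_univ k))

end Entropy

/-! ### Representations of `M_{d_1} ⊕ ⋯ ⊕ M_{d_k}` -/

section Representation

universe u

variable {X : Type u} [Fintype X] [DecidableEq X]

/-- The eigenvalues are `0` or `1`; the columns of `v` are the eigenvectors for `1`. -/
theorem exists_isometry_of_projection {p : Matrix X X ℂ} (hp : p.IsHermitian) (hpp : p * p = p) :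
    ∃ (J : Type u) (_ : Fintype J) (_ : DecidableEq J) (v : Matrix X J ℂ),
      v * vᴴ = p ∧ vᴴ * v = 1 := by
  set l := hp.eigenvalues
  set U : Matrix X X ℂ := (hp.eigenvectorUnitary).1
  have hU : U * Uᴴ = 1 := eigenvectorUnitary_mul_conjTranspose hp
  have hU' : Uᴴ * U = 1 := mul_eq_one_comm.1 hU
  have hdiag : Uᴴ * p * U = diagonal fun k => (l k : ℂ) := eigenvectorUnitary_conj hp
  have hl : ∀ k, l k ≠ 0 → l k = 1 := by
    intro k hk
    have h : (Uᴴ * p * U) * (Uᴴ * p * U) = Uᴴ * p * U := by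
      calc _ = Uᴴ * p * (U * Uᴴ) * p * U := by simp only [Matrix.mul_assoc]
        _ = Uᴴ * (p * p) * U := by rw [hU, Matrix.mul_one, Matrix.mul_assoc Uᴴ p p]
        _ = _ := by rw [hpp]
    rw [hdiag, diagonal_mul_diagonal] at h
    have h2 := congrFun (congrFun h k) k
    rw [diagonal_apply_eq, diagonal_apply_eq] at h2
    have h3 : l k * l k = l k := by exact_mod_cast h2
    exact mul_left_cancel₀ hk (by rw [h3, mul_one])
  have hp2 : p = U * (diagonal fun k => (l k : ℂ)) * Uᴴ := by
    rw [← hdiag]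
    calc p = (U * Uᴴ) * p * (U * Uᴴ) := by rw [hU, Matrix.one_mul, Matrix.mul_one]
      _ = _ := by simp only [Matrix.mul_assoc]
  refine ⟨{k // l k ≠ 0}, inferInstance, inferInstance, U.submatrix id Subtype.val, ?_, ?_⟩
  · ext x y
    rw [hp2, mul_apply, mul_apply]
    simp only [mul_diagonal, conjTranspose_apply, submatrix_apply, id_eq]
    have h := Finset.sum_subtype (Finset.univ.filter fun k => l k ≠ 0)
      (p := fun k => l k ≠ 0) (F := inferInstance) (by simp) (fun k => U x k * star (U y k))
    rw [Finset.sum_filter] at h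
    refine h.symm.trans (Finset.sum_congr rfl fun k _ => ?_)
    rcases eq_or_ne (l k) 0 with h0 | h0
    · simp [h0]
    · simp [hl k h0]
  · ext j j'
    have := congrFun (congrFun hU' j.1) j'.1
    rw [mul_apply] at this ⊢
    simpa [one_apply, Subtype.ext_iff] using this

variable {k : ℕ} {d : Fin k → ℕ}

/-- The structure theorem for representations: `J i` indexes an orthonormal basis of the range of
the minimal projection `e i o o`, which is the multiplicity space of block `i` (possibly zero). The
matrix units carry each basis vector to a copy of `ℂ^(d i)`, and `V i j` is the isometry onto that
copy. -/
theorem exists_isometries (hd : ∀ i, 0 < d i)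
    (π : (∀ i, Matrix (Fin (d i)) (Fin (d i)) ℂ) →⋆ₐ[ℂ] Matrix X X ℂ) :
    ∃ (J : Fin k → Type u) (_ : ∀ i, Fintype (J i)) (_ : ∀ i, DecidableEq (J i))
      (V : ∀ i, J i → Matrix X (Fin (d i)) ℂ),
      (∀ Y, π Y = ∑ i, ∑ j, V i j * Y i * (V i j)ᴴ) ∧
      (∀ i j, (V i j)ᴴ * V i j = 1) ∧
      ∀ i j i' j', (⟨i, j⟩ : Σ i, J i) ≠ ⟨i', j'⟩ → (V i j)ᴴ * V i' j' = 0 := by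
  let o : ∀ i, Fin (d i) := fun i => ⟨0, hd i⟩
  let e : ∀ i, Fin (d i) → Fin (d i) → Matrix X X ℂ := fun i a b => π (Pi.single i (single a b 1))
  have he_star : ∀ i a b, (e i a b)ᴴ = e i b a := by
    intro i a b
    rw [← star_eq_conjTranspose, ← map_star]
    congr 1
    rw [← Pi.single_star, star_eq_conjTranspose, conjTranspose_single, star_one]
  have he_mul : ∀ i a b c, e i a b * e i b c = e i a c := by
    intro i a b c
    simp only [e]
    rw [← map_mul, ← Pi.single_mul, single_mul_single_same, mul_one]
  have he_mul_ne : ∀ i a b b' c, b ≠ b' → e i a b * e i b' c = 0 := by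
    intro i a b b' c h
    simp only [e]
    rw [← map_mul, ← Pi.single_mul, single_mul_single_of_ne _ _ _ _ h, Pi.single_zero, map_zero]
  have he_mul_ne' : ∀ i i' a b a' b', i ≠ i' → e i a b * e i' a' b' = 0 := by
    intro i i' a b a' b' h
    simp only [e]
    rw [← map_mul, ← Pi.single_mul_left, Pi.single_eq_of_ne h, mul_zero, Pi.single_zero, map_zero]
  choose J hJ hJ' v hv hv' using fun i =>
    exists_isometry_of_projection (p := e i (o i) (o i)) (he_star i _ _) (he_mul i _ _ _)
  -- Column `a` of `V i j` is `e i a o` applied to the `j`-th basis vector.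
  let V : ∀ i, J i → Matrix X (Fin (d i)) ℂ := fun i j => of fun x a => (e i a (o i) * v i) x j
  have hVV : ∀ i j i' j' a a', ((V i j)ᴴ * V i' j') a a' =
      ((v i)ᴴ * (e i (o i) a * e i' a' (o i')) * v i') j j' := by
    intro i j i' j' a a'
    have : (v i)ᴴ * (e i (o i) a * e i' a' (o i')) * v i' =
        (e i a (o i) * v i)ᴴ * (e i' a' (o i') * v i') := by
      rw [conjTranspose_mul, he_star]
      simp only [Matrix.mul_assoc]
    rw [this, mul_apply, mul_apply]
    rfl
  have hcomp : ∀ i, (v i)ᴴ * e i (o i) (o i) * v i = 1 := by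
    intro i
    rw [← hv i, ← Matrix.mul_assoc, hv', Matrix.one_mul, hv']
  refine ⟨J, hJ, hJ', V, ?_, ?_, ?_⟩
  · intro Y
    have h1 : Y = ∑ i, ∑ a, ∑ b, Y i a b • Pi.single i (single a b (1 : ℂ)) := by
      conv_lhs => rw [← Finset.univ_sum_single Y]
      refine Finset.sum_congr rfl fun i _ => ?_
      conv_lhs => rw [matrix_eq_sum_single (Y i)]
      have h0 : ∀ M : Matrix (Fin (d i)) (Fin (d i)) ℂ, Pi.single i M =
        AddMonoidHom.single (fun i => Matrix (Fin (d i)) (Fin (d i)) ℂ) i M := fun _ => rfl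
      simp only [h0, map_sum]
      simp only [← h0, ← Pi.single_smul, smul_single, smul_eq_mul, mul_one]
    have h2 : π Y = ∑ i, ∑ a, ∑ b, Y i a b • e i a b := by
      conv_lhs => rw [h1]
      simp only [map_sum, map_smul, e]
    rw [h2]
    refine Finset.sum_congr rfl fun i _ => ?_
    ext x y
    have h3 : ∀ a b, e i a b = (e i a (o i) * v i) * (e i b (o i) * v i)ᴴ := by
      intro a b
      rw [conjTranspose_mul, he_star, Matrix.mul_assoc, ← Matrix.mul_assoc (v i), hv,
        ← Matrix.mul_assoc, he_mul, he_mul]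
    simp only [Matrix.sum_apply, Matrix.smul_apply, smul_eq_mul]
    have h4 : ∀ a b, e i a b x y = ∑ j, V i j x a * star (V i j y b) := by
      intro a b
      rw [h3, mul_apply]
      rfl
    simp only [h4, mul_apply (M := _ * _), mul_apply (M := V _ _), conjTranspose_apply,
      Finset.sum_mul, Finset.mul_sum]
    rw [Finset.sum_comm]
    simp only [Finset.sum_comm (s := (Finset.univ : Finset (J i)))]
    refine Finset.sum_congr rfl fun b _ => Finset.sum_congr rfl fun a _ =>
      Finset.sum_congr rfl fun j _ => by ring
  · intro i j
    ext a a'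
    rw [hVV]
    rcases eq_or_ne a a' with rfl | h
    · rw [he_mul, hcomp, one_apply_eq, one_apply_eq]
    · rw [he_mul_ne _ _ _ _ _ h, Matrix.mul_zero, Matrix.zero_mul, one_apply_ne h]
      rfl
  · intro i j i' j' hne
    ext a a'
    rw [hVV]
    rcases eq_or_ne i i' with rfl | h
    · have hj : j ≠ j' := fun h => hne (by rw [h])
      rcases eq_or_ne a a' with rfl | h
      · rw [he_mul, hcomp, one_apply_ne hj]
        rfl
      · rw [he_mul_ne _ _ _ _ _ h, Matrix.mul_zero, Matrix.zero_mul]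
        rfl
    · rw [he_mul_ne' _ _ _ _ _ _ h, Matrix.mul_zero, Matrix.zero_mul]
      rfl

end Representation

/-! ### Comparison of the entropies of a state and of its restriction -/

section Comparison

universe u

variable {X : Type u} [Fintype X] [DecidableEq X]

/-- Each `V i j (V i j)ᴴ` lies in the commutant because `V i j` intertwines. These projections are
nonzero, as `d i > 0`, and mutually orthogonal, hence linearly independent. -/
theorem card_le_finrank_centralizer {k : ℕ} {d : Fin k → ℕ} (hd : ∀ i, 0 < d i)
    {π : (∀ i, Matrix (Fin (d i)) (Fin (d i)) ℂ) →⋆ₐ[ℂ] Matrix X X ℂ}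
    {J : Fin k → Type u} [∀ i, Fintype (J i)]
    {V : ∀ i, J i → Matrix X (Fin (d i)) ℂ}
    (hπ : ∀ Y, π Y = ∑ i, ∑ j, V i j * Y i * (V i j)ᴴ)
    (h1 : ∀ i j, (V i j)ᴴ * V i j = 1)
    (h0 : ∀ i j i' j', (⟨i, j⟩ : Σ i, J i) ≠ ⟨i', j'⟩ → (V i j)ᴴ * V i' j' = 0) :
    Fintype.card (Σ i, J i) ≤
      Module.finrank ℂ (Subalgebra.centralizer ℂ (Set.range π)) := by
  classical
  have hleft : ∀ Y i j, π Y * V i j = V i j * Y i := by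
    intro Y i j
    rw [hπ, ← Fintype.sum_sigma fun s : Σ i, J i => V s.1 s.2 * Y s.1 * (V s.1 s.2)ᴴ,
      Matrix.sum_mul, Finset.sum_eq_single (⟨i, j⟩ : Σ i, J i)]
    · rw [Matrix.mul_assoc, h1, Matrix.mul_one]
    · intro s _ hs
      rw [Matrix.mul_assoc, h0 _ _ _ _ hs, Matrix.mul_zero]
    · simp
  have hright : ∀ Y i j, (V i j)ᴴ * π Y = Y i * (V i j)ᴴ := by
    intro Y i j
    have h := congrArg conjTranspose (hleft (star Y) i j)
    rw [conjTranspose_mul, conjTranspose_mul, map_star, star_eq_conjTranspose,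
      conjTranspose_conjTranspose, Pi.star_apply, star_eq_conjTranspose,
      conjTranspose_conjTranspose] at h
    exact h
  let Q : (Σ i, J i) → Subalgebra.centralizer ℂ (Set.range π) := fun s =>
    ⟨V s.1 s.2 * (V s.1 s.2)ᴴ, by
      rw [Subalgebra.mem_centralizer_iff]
      rintro _ ⟨Y, rfl⟩
      rw [← Matrix.mul_assoc, hleft, Matrix.mul_assoc _ _ (π Y), hright, Matrix.mul_assoc]⟩
  have hQ : LinearIndependent ℂ Q := by
    rw [Fintype.linearIndependent_iff]
    intro g hg t
    have h2 : ∑ s, g s • (V s.1 s.2 * (V s.1 s.2)ᴴ) = 0 := by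
      simpa [Q] using congrArg Subtype.val hg
    have h3 := congrArg (fun M => (V t.1 t.2)ᴴ * M * V t.1 t.2) h2
    simp only [Matrix.mul_sum, Matrix.sum_mul, Matrix.mul_zero, Matrix.zero_mul] at h3
    rw [Finset.sum_eq_single t] at h3
    · rw [Matrix.mul_smul, Matrix.smul_mul, ← Matrix.mul_assoc, h1, Matrix.one_mul, h1] at h3
      have h4 := congrFun (congrFun h3 ⟨0, hd t.1⟩) ⟨0, hd t.1⟩
      simpa using h4
    · intro s _ hs
      rw [Matrix.mul_smul, Matrix.smul_mul, ← Matrix.mul_assoc, h0 _ _ _ _ hs.symm,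
        Matrix.zero_mul, Matrix.zero_mul, smul_zero]
    · simp
  exact hQ.fintype_card_le_finrank

/-- If the commutant of a representation of `A` has dimension at most `K`, then a state of the full
matrix algebra and its restriction to `A` have entropies that differ by at most `log K`. -/
theorem abs_entropy_sub_spectralEntropy_le {A : Type*} [Ring A] [StarRing A] [Algebra ℂ A]
    (P : BlockDecomposition A) (π : A →⋆ₐ[ℂ] Matrix X X ℂ) {D : Matrix X X ℂ}
    (hD : D.PosSemidef) (htr : D.trace = 1) (φ : A →ₗ[ℂ] ℂ) (hφ : ∀ a, φ a = (D * π a).trace)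
    {K : ℕ} (hK1 : 1 ≤ K)
    (hK : Module.finrank ℂ (Subalgebra.centralizer ℂ (Set.range π)) ≤ K) :
    |P.entropy φ - spectralEntropy D| ≤ Real.log K := by
  obtain ⟨J, hJ, hJ', V, hV, h1, h0⟩ := exists_isometries P.dim_pos
    (π.comp (P.iso.symm : _ →⋆ₐ[ℂ] A))
  have hV' : ∀ Y, π (P.iso.symm Y) = ∑ i, ∑ j, V i j * Y i * (V i j)ᴴ := hV
  have hcard : Fintype.card (Σ i, J i) ≤ K := by
    have hr : Set.range (π.comp
        (P.iso.symm : (∀ i, Matrix (Fin (P.dim i)) (Fin (P.dim i)) ℂ) →⋆ₐ[ℂ] A)) = Set.range π := by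
      ext T
      constructor
      · rintro ⟨Y, rfl⟩
        exact ⟨_, rfl⟩
      · rintro ⟨a, rfl⟩
        exact ⟨P.iso a, congrArg π (P.iso.symm_apply_apply a)⟩
    refine (card_le_finrank_centralizer P.dim_pos hV h1 h0).trans ?_
    rwa [hr]
  have hone : ∑ i, ∑ j, V i j * (V i j)ᴴ = 1 := by
    have := hV' 1
    rw [map_one, map_one] at this
    simpa using this.symm
  -- The block of the restricted density is a partial trace over the multiplicity space.
  have hdens : ∀ i, P.density φ i = ∑ j, (V i j)ᴴ * D * V i j := by
    intro i
    ext a b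
    rw [BlockDecomposition.density, densityMatrix, of_apply]
    change φ (P.iso.symm (Pi.single i (single b a 1))) = _
    rw [hφ, hV', Finset.sum_eq_single i]
    · rw [Finset.mul_sum, trace_sum, Matrix.sum_apply]
      refine Finset.sum_congr rfl fun j _ => ?_
      rw [Pi.single_eq_same, ← Matrix.mul_assoc, ← Matrix.mul_assoc, trace_mul_comm,
        ← Matrix.mul_assoc, ← Matrix.mul_assoc, trace_mul_single]
      simp
    · intro i' _ h
      simp [Pi.single_eq_of_ne h]
    · simp
  have hent : P.entropy φ = ∑ i, spectralEntropy (∑ j, (V i j)ᴴ * D * V i j) :=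
    Finset.sum_congr rfl fun i _ => by rw [hdens]; rfl
  have hpos : ∀ i, (∑ j, (V i j)ᴴ * D * V i j).PosSemidef := fun i =>
    posSemidef_sum _ fun j _ => hD.conjTranspose_mul_mul_same _
  have hK1' : (1 : ℝ) ≤ K := by exact_mod_cast hK1
  rw [hent, abs_sub_le_iff]
  constructor
  -- Upper bound on the restricted entropy: write `D = W Wᴴ` with scaled eigenvectors as columns.
  -- Each eigenvalue `l k` splits into the weights `q k (i, j)` of its components in the at most `K`
  -- irreducible summands.
  · set l := hD.isHermitian.eigenvalues
    set U : Matrix X X ℂ := (hD.isHermitian.eigenvectorUnitary).1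
    have hU : U * Uᴴ = 1 := eigenvectorUnitary_mul_conjTranspose hD.isHermitian
    have hU' : Uᴴ * U = 1 := mul_eq_one_comm.1 hU
    have hl : ∀ k, 0 ≤ l k := hD.eigenvalues_nonneg
    set R : Matrix X X ℂ := diagonal fun k => ((√(l k) : ℝ) : ℂ)
    have hR : Rᴴ = R := by
      rw [diagonal_conjTranspose]
      congr 1
      ext k
      simp
    have hRR : R * R = diagonal fun k => (l k : ℂ) := by
      rw [diagonal_mul_diagonal]
      congr 1
      ext k
      rw [← Complex.ofReal_mul, Real.mul_self_sqrt (hl k)]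
    have hUR : U * R * (U * R)ᴴ = D := by
      rw [conjTranspose_mul, hR, Matrix.mul_assoc, ← Matrix.mul_assoc R, hRR,
        ← eigenvectorUnitary_conj hD.isHermitian]
      change U * (Uᴴ * D * U * Uᴴ) = D
      rw [Matrix.mul_assoc _ U, hU, Matrix.mul_one, ← Matrix.mul_assoc, hU, Matrix.one_mul]
    have hUR' : (U * R)ᴴ * (U * R) = diagonal fun k => (l k : ℂ) := by
      rw [conjTranspose_mul, hR, Matrix.mul_assoc, ← Matrix.mul_assoc Uᴴ, hU', Matrix.one_mul, hRR]
    set W : Matrix X X ℂ := U * R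
    let q : X → (Σ i, J i) → ℝ := fun k s => ((Wᴴ * (V s.1 s.2 * (V s.1 s.2)ᴴ) * W) k k).re
    have hq0 : ∀ k s, 0 ≤ q k s := fun k s =>
      (Complex.nonneg_iff.1 (((posSemidef_self_mul_conjTranspose (V s.1 s.2)
        ).conjTranspose_mul_mul_same W).diag_nonneg)).1
    have hq : ∀ k, ∑ s, q k s = l k := by
      intro k
      have h2 : ∑ s : Σ i, J i, Wᴴ * (V s.1 s.2 * (V s.1 s.2)ᴴ) * W =
          diagonal fun k => (l k : ℂ) := by
        rw [← Matrix.sum_mul, ← Matrix.mul_sum,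
          Fintype.sum_sigma fun s : Σ i, J i => V s.1 s.2 * (V s.1 s.2)ᴴ, hone, Matrix.mul_one,
          hUR']
      have h3 := congrArg Complex.re (congrFun (congrFun h2 k) k)
      rwa [Matrix.sum_apply, Complex.re_sum, diagonal_apply_eq, Complex.ofReal_re] at h3
    have hle : ∀ i, spectralEntropy (∑ j, (V i j)ᴴ * D * V i j) ≤
        ∑ k, ∑ j, Real.negMulLog (q k ⟨i, j⟩) := by
      intro i
      -- The columns `(V i j)ᴴ w_k` decompose block `i` of the restricted density.
      let Z : Matrix (Fin (P.dim i)) (X × J i) ℂ := of fun a s => ((V i s.2)ᴴ * W) a s.1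
      have h2 : Z * Zᴴ = ∑ j, (V i j)ᴴ * D * V i j := by
        ext a b
        rw [mul_apply, Fintype.sum_prod_type_right, Matrix.sum_apply]
        refine Finset.sum_congr rfl fun j _ => ?_
        have h3 : (V i j)ᴴ * D * V i j = ((V i j)ᴴ * W) * ((V i j)ᴴ * W)ᴴ := by
          rw [conjTranspose_mul, conjTranspose_conjTranspose, ← hUR]
          simp only [Matrix.mul_assoc]
        rw [h3, mul_apply]
        rfl
      have h4 := spectralEntropy_mul_conjTranspose_le Z
      rw [h2, Fintype.sum_prod_type] at h4
      refine h4.trans (le_of_eq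
        (Finset.sum_congr rfl fun k _ => Finset.sum_congr rfl fun j _ => ?_))
      have h3 : Wᴴ * (V i j * (V i j)ᴴ) * W = ((V i j)ᴴ * W)ᴴ * ((V i j)ᴴ * W) := by
        rw [conjTranspose_mul (V i j)ᴴ, conjTranspose_conjTranspose]
        simp only [Matrix.mul_assoc]
      simp only [q, h3]
      rfl
    have hsum : ∑ k, l k = 1 := by
      have := hD.isHermitian.trace_eq_sum_eigenvalues
      rw [htr] at this
      exact Complex.ofReal_injective (by push_cast; exact this.symm)
    have hfin : ∑ k, ∑ s, Real.negMulLog (q k s) ≤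
        ∑ k, (Real.negMulLog (l k) + l k * Real.log K) :=
      Finset.sum_le_sum fun k _ => by
        have := sum_negMulLog_le_add_log_card (q k) (hq0 k) hK1' (by exact_mod_cast hcard)
        rwa [hq] at this
    rw [Finset.sum_add_distrib, ← Finset.sum_mul, hsum, one_mul] at hfin
    rw [spectralEntropy_eq_sum hD.isHermitian, sub_le_iff_le_add']
    refine (Finset.sum_le_sum fun i _ => hle i).trans (le_trans (le_of_eq ?_) hfin)
    rw [Finset.sum_comm]
    exact Finset.sum_congr rfl fun k _ =>
      (Fintype.sum_sigma fun s : Σ i, J i => Real.negMulLog (q k s)).symm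
  -- Upper bound on the entropy of `D`: test `D` on the vectors `V i j u_a`, with `u_a` an
  -- eigenbasis of block `i`. For fixed `(i, a)` the diagonal entries sum over `j` to the eigenvalue
  -- `l i a`, with at most `K` terms.
  · let U : ∀ i, Matrix (Fin (P.dim i)) (Fin (P.dim i)) ℂ := fun i =>
      ((hpos i).isHermitian.eigenvectorUnitary).1
    let l : ∀ i, Fin (P.dim i) → ℝ := fun i => (hpos i).isHermitian.eigenvalues
    have hU : ∀ i, U i * (U i)ᴴ = 1 := fun i =>
      eigenvectorUnitary_mul_conjTranspose (hpos i).isHermitian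
    let Z : Matrix X (Σ i, J i × Fin (P.dim i)) ℂ := of fun x s => (V s.1 s.2.1 * U s.1) x s.2.2
    have hZ : Z * Zᴴ = 1 := by
      ext x y
      rw [← hone, mul_apply, Fintype.sum_sigma, Matrix.sum_apply]
      refine Finset.sum_congr rfl fun i _ => ?_
      rw [Fintype.sum_prod_type, Matrix.sum_apply]
      refine Finset.sum_congr rfl fun j _ => ?_
      have h3 : V i j * (V i j)ᴴ = (V i j * U i) * (V i j * U i)ᴴ := by
        rw [conjTranspose_mul, Matrix.mul_assoc, ← Matrix.mul_assoc (U i), hU, Matrix.one_mul]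
      rw [h3, mul_apply]
      rfl
    let q : ∀ i, Fin (P.dim i) → J i → ℝ := fun i a j =>
      (((U i)ᴴ * ((V i j)ᴴ * D * V i j) * U i) a a).re
    have hq0 : ∀ i a j, 0 ≤ q i a j := fun i a j =>
      (Complex.nonneg_iff.1 (((hD.conjTranspose_mul_mul_same _).conjTranspose_mul_mul_same
        (U i)).diag_nonneg)).1
    have hq : ∀ i a, ∑ j, q i a j = l i a := by
      intro i a
      have h2 : ∑ j, (U i)ᴴ * ((V i j)ᴴ * D * V i j) * U i = diagonal fun k => (l i k : ℂ) := by
        rw [← Matrix.sum_mul, ← Matrix.mul_sum]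
        exact eigenvectorUnitary_conj (hpos i).isHermitian
      have h3 := congrArg Complex.re (congrFun (congrFun h2 a) a)
      rwa [Matrix.sum_apply, Complex.re_sum, diagonal_apply_eq, Complex.ofReal_re] at h3
    have hle := spectralEntropy_le_of_mul_conjTranspose_eq_one hD Z hZ
    have heq : ∀ i j a, (Zᴴ * D * Z) ⟨i, j, a⟩ ⟨i, j, a⟩ =
        ((U i)ᴴ * ((V i j)ᴴ * D * V i j) * U i) a a := by
      intro i j a
      have h3 : (U i)ᴴ * ((V i j)ᴴ * D * V i j) * U i = (V i j * U i)ᴴ * D * (V i j * U i) := by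
        rw [conjTranspose_mul]
        simp only [Matrix.mul_assoc]
      rw [h3]
      simp only [mul_apply (N := Z), mul_apply (N := V i j * U i), mul_apply (N := D)]
      rfl
    have hsum : ∑ i, ∑ a, l i a = 1 := by
      have h2 : ∀ i, ∑ a, (l i a : ℂ) = (∑ j, (V i j)ᴴ * D * V i j).trace := fun i =>
        (hpos i).isHermitian.trace_eq_sum_eigenvalues.symm
      apply Complex.ofReal_injective
      push_cast
      simp only [h2, trace_sum]
      rw [← htr]
      conv_rhs => rw [← Matrix.mul_one D, ← hone]
      simp only [Matrix.mul_sum, trace_sum]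
      refine Finset.sum_congr rfl fun i _ => Finset.sum_congr rfl fun j _ => ?_
      rw [Matrix.mul_assoc, trace_mul_comm, Matrix.mul_assoc]
    have hJK : ∀ i, (Fintype.card (J i) : ℝ) ≤ K := fun i => by
      refine le_trans ?_ (show (Fintype.card (Σ i, J i) : ℝ) ≤ K by exact_mod_cast hcard)
      exact_mod_cast Fintype.card_le_of_injective (fun j => (⟨i, j⟩ : Σ i, J i))
        sigma_mk_injective
    have hfin : ∑ i, ∑ a, ∑ j, Real.negMulLog (q i a j) ≤
        ∑ i, ∑ a, (Real.negMulLog (l i a) + l i a * Real.log K) :=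
      Finset.sum_le_sum fun i _ => Finset.sum_le_sum fun a _ => by
        have := sum_negMulLog_le_add_log_card (q i a) (hq0 i a) hK1' (hJK i)
        rwa [hq] at this
    simp only [Finset.sum_add_distrib, ← Finset.sum_mul, hsum, one_mul] at hfin
    have hS : ∀ i, spectralEntropy (∑ j, (V i j)ᴴ * D * V i j) = ∑ a, Real.negMulLog (l i a) :=
      fun i => spectralEntropy_eq_sum (hpos i).isHermitian
    simp only [hS]
    rw [sub_le_iff_le_add']
    refine hle.trans (le_trans (le_of_eq ?_) hfin)
    rw [Fintype.sum_sigma]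
    refine Finset.sum_congr rfl fun i _ => ?_
    rw [Fintype.sum_prod_type_right]
    exact Finset.sum_congr rfl fun a _ => Finset.sum_congr rfl fun j _ => by rw [heq]

end Comparison

/-! ### Existence of block decompositions -/

/-- The inner automorphism `Y ↦ u Y u⁻¹` of a matrix algebra. -/
def innerAlgEquiv {n : Type*} [Fintype n] [DecidableEq n] (u : (Matrix n n ℂ)ˣ) :
    Matrix n n ℂ ≃ₐ[ℂ] Matrix n n ℂ where
  toFun Y := ↑u * Y * ↑u⁻¹
  invFun Y := ↑u⁻¹ * Y * ↑u
  left_inv Y := by simp [mul_assoc]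
  right_inv Y := by simp [mul_assoc]
  map_mul' Y Z := by simp [mul_assoc]
  map_add' Y Z := by simp [mul_add, add_mul]
  commutes' c := by simp [Algebra.algebraMap_eq_smul_one]

section BlockDecomposition

variable {X : Type*} [Fintype X] [DecidableEq X] {A : Type*} [Ring A] [StarRing A] [Algebra ℂ A]

/-- For `x` in the radical, `x* x` is nilpotent, and a self-adjoint nilpotent element of a
C*-algebra is zero; hence `x = 0`. -/
theorem isSemisimpleRing_of_injective [FiniteDimensional ℂ A] (π : A →⋆ₐ[ℂ] Matrix X X ℂ)
    (hπ : Function.Injective π) : IsSemisimpleRing A := by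
  have : IsArtinianRing A := IsArtinianRing.of_finite ℂ A
  rw [IsArtinianRing.isSemisimpleRing_iff_jacobson, eq_bot_iff]
  intro x hx
  obtain ⟨n, hn⟩ := IsSemiprimaryRing.isNilpotent (R := A)
  have h1 : (star x * x) ^ n = 0 := by
    have := Ideal.pow_mem_pow (Ideal.mul_mem_left _ (star x) hx) n
    rwa [hn] at this
  -- The exponent is a power of `2` because the C*-identity computes the norms of exactly these
  -- powers.
  have h2 : (star (π x) * π x) ^ 2 ^ n = 0 := by
    rw [← map_star, ← map_mul, ← map_pow,
      pow_eq_zero_of_le (Nat.lt_two_pow_self (n := n)).le h1, map_zero]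
  have h3 := (IsSelfAdjoint.star_mul_self (π x)).norm_pow_two_pow n
  rw [h2, norm_zero] at h3
  have h4 : star (π x) * π x = 0 :=
    norm_eq_zero.1 (pow_eq_zero_iff (by positivity) |>.1 h3.symm)
  have h5 : π x = 0 := CStarRing.star_mul_self_eq_zero_iff _ |>.1 h4
  exact hπ (by rw [h5, map_zero])

/-- The block map `q` need not respect the involution. A nonzero column of the image of a matrix
unit yields `W` with `π y * W = W * q y`; as `π` preserves the involution, the Gram matrix `Wᴴ W`
measures the defect of `q`. -/
theorem exists_gram_intertwining {n : ℕ} (hn : 0 < n) (π : A →⋆ₐ[ℂ] Matrix X X ℂ)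
    (hπ : Function.Injective π) (q : A →ₐ[ℂ] Matrix (Fin n) (Fin n) ℂ)
    (r : Matrix (Fin n) (Fin n) ℂ →ₗ[ℂ] A) (hr : Function.Injective r)
    (hrq : ∀ y Y, y * r Y = r (q y * Y)) (hqr : ∀ Y, q (r Y) = Y) :
    ∃ h : Matrix (Fin n) (Fin n) ℂ, h.PosDef ∧ ∀ y, h * q (star y) = (q y)ᴴ * h := by
  let o : Fin n := ⟨0, hn⟩
  have hp : π (r (single o o 1)) ≠ 0 := by
    rw [Ne, map_eq_zero_iff _ hπ, map_eq_zero_iff _ hr]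
    intro h
    simpa using congrFun (congrFun h o) o
  obtain ⟨x₁, x₀, hx⟩ : ∃ x₁ x₀, π (r (single o o 1)) x₁ x₀ ≠ 0 := by
    by_contra! hc
    exact hp (Matrix.ext hc)
  let W : Matrix X (Fin n) ℂ := of fun x a => π (r (single a o 1)) x x₀
  have hW : ∀ y, π y * W = W * q y := by
    intro y
    ext x b
    have h1 : π y * π (r (single b o 1)) = ∑ a, q y a b • π (r (single a o 1)) := by
      rw [← map_mul, hrq]
      have : q y * single b o 1 = ∑ a, q y a b • single a o (1 : ℂ) := by
        ext i j
        rw [Matrix.sum_apply]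
        by_cases hj : j = o
        · subst hj
          simp [single_apply]
        · simp [hj, Ne.symm hj]
      rw [this]
      simp only [map_sum, map_smul]
    have h2 := congrFun (congrFun h1 x) x₀
    rw [mul_apply, Matrix.sum_apply] at h2
    rw [mul_apply, mul_apply]
    refine h2.trans (Finset.sum_congr rfl fun a _ => ?_)
    rw [Matrix.smul_apply, smul_eq_mul, mul_comm]
    rfl
  have hinj : Function.Injective W.mulVec := by
    rw [← coe_mulVecLin, injective_iff_map_eq_zero]
    intro c hc
    rw [mulVecLin_apply] at hc
    ext b
    -- Moving the matrix unit through `W` isolates `c b` times column `o` of `W`, whose entry at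
    -- `x₁` is nonzero.
    have h1 : (π (r (single o b 1)) * W) *ᵥ c = 0 := by
      rw [← mulVec_mulVec, hc, mulVec_zero]
    rw [hW, hqr] at h1
    have h2 := congrFun h1 x₁
    rw [← mulVec_mulVec] at h2
    have h3 : single o b (1 : ℂ) *ᵥ c = Pi.single o (c b) := by
      ext i
      by_cases hi : i = o
      · simp [mulVec, dotProduct, single_apply, hi]
      · simp [mulVec, dotProduct, hi, Ne.symm hi]
    rw [h3, mulVec_single] at h2
    simpa [W, hx] using h2
  refine ⟨Wᴴ * W, PosDef.conjTranspose_mul_self W hinj, fun y => ?_⟩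
  rw [Matrix.mul_assoc, ← hW, map_star, star_eq_conjTranspose, ← Matrix.mul_assoc,
    ← conjTranspose_mul, hW, conjTranspose_mul, Matrix.mul_assoc]

/-- Wedderburn's theorem gives only an algebra isomorphism. Conjugating each block by the square
root of its Gram matrix `h` makes it preserve the involution. -/
theorem BlockDecomposition.nonempty_of_injective (π : A →⋆ₐ[ℂ] Matrix X X ℂ)
    (hπ : Function.Injective π) : Nonempty (BlockDecomposition A) := by
  have : FiniteDimensional ℂ A := FiniteDimensional.of_injective π.toAlgHom.toLinearMap hπ
  have := isSemisimpleRing_of_injective π hπ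
  obtain ⟨k, d, hd, ⟨e⟩⟩ := IsSemisimpleRing.exists_algEquiv_pi_matrix_of_isAlgClosed ℂ A
  have hd0 : ∀ i, 0 < d i := fun i => Nat.pos_of_ne_zero (hd i).out
  have key : ∀ i, ∃ u : (Matrix (Fin (d i)) (Fin (d i)) ℂ)ˣ, ∀ y,
      innerAlgEquiv u (e (star y) i) = (innerAlgEquiv u (e y i))ᴴ := by
    intro i
    obtain ⟨h, hh, hs⟩ := exists_gram_intertwining (hd0 i) π hπ
      ((Pi.evalAlgHom ℂ _ i).comp e.toAlgHom)
      (e.symm.toLinearMap ∘ₗ LinearMap.single ℂ (fun i => Matrix (Fin (d i)) (Fin (d i)) ℂ) i)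
      (e.symm.injective.comp
        (Pi.single_injective (M := fun i => Matrix (Fin (d i)) (Fin (d i)) ℂ) i))
      (fun y Y => by
        apply e.injective
        rw [map_mul]
        change e y * e (e.symm (Pi.single i Y)) = e (e.symm (Pi.single i (e y i * Y)))
        rw [e.apply_symm_apply, e.apply_symm_apply, Pi.single_mul_right])
      (fun Y => by
        change e (e.symm (Pi.single i Y)) i = Y
        rw [e.apply_symm_apply, Pi.single_eq_same])
    replace hs : ∀ y, h * e (star y) i = (e y i)ᴴ * h := hs
    set K := CFC.sqrt h
    have hK : Kᴴ = K := (CFC.sqrt_nonneg h).isSelfAdjoint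
    have hKK : K * K = h := CFC.sqrt_mul_sqrt_self h hh.posSemidef.nonneg
    have hKu : IsUnit K := by
      have := hh.isUnit
      rw [← hKK] at this
      exact isUnit_of_mul_isUnit_left this
    obtain ⟨u, hu⟩ := hKu
    have huH : u⁻¹.1ᴴ = u⁻¹.1 := by
      have h1 : u⁻¹.1ᴴ * u.1 = 1 := by
        rw [← conjTranspose_one, ← u.mul_inv, conjTranspose_mul, hu, hK]
      exact Units.eq_inv_of_mul_eq_one_left (mul_eq_one_comm.1 h1)
    refine ⟨u, fun y => ?_⟩
    change u.1 * e (star y) i * u⁻¹.1 = (u.1 * e y i * u⁻¹.1)ᴴ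
    have h2 := hs y
    rw [← hKK, ← hu] at h2
    have h3 := congrArg (fun M => u⁻¹.1 * M * u⁻¹.1) h2
    simp only [Matrix.mul_assoc, Units.mul_inv, Matrix.mul_one, Units.inv_mul_cancel_left] at h3
    rw [conjTranspose_mul, conjTranspose_mul, huH, hu, hK, ← hu, Matrix.mul_assoc]
    exact h3
  choose u hu using key
  exact ⟨⟨k, d, hd0, .ofAlgEquiv (e.trans (.piCongrRight fun i => innerAlgEquiv (u i)))
    fun y => funext fun i => hu i y⟩⟩

end BlockDecomposition

/-! ### Matrix units of the local algebras -/

section MatrixUnits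

variable {X : Type*} [Fintype X] [DecidableEq X] {B : Type*} [Ring B] [StarRing B] [Algebra ℂ B]
  [StarModule ℂ B]

/-- The representation of a full matrix algebra given by a system of matrix units. -/
def matrixUnitHom (u : X → X → B)
    (hmul : ∀ s t s' t', u s t * u s' t' = if t = s' then u s t' else 0)
    (hstar : ∀ s t, star (u s t) = u t s) (hone : ∑ s, u s s = 1) :
    Matrix X X ℂ →⋆ₐ[ℂ] B where
  toFun M := ∑ s, ∑ t, M s t • u s t
  map_one' := by
    rw [← hone]
    exact Finset.sum_congr rfl fun s _ => by simp [one_apply, ite_smul]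
  map_mul' M N := by
    have h : ∀ s t, (M s t • u s t) * ∑ s', ∑ t', N s' t' • u s' t' =
        ∑ t', (M s t * N t t') • u s t' := by
      intro s t
      simp only [Finset.mul_sum, smul_mul_smul_comm, hmul, smul_ite, smul_zero]
      rw [Finset.sum_comm]
      simp
    simp only [Finset.sum_mul, h, mul_apply, Finset.sum_smul]
    exact Finset.sum_congr rfl fun s _ => Finset.sum_comm
  map_zero' := by simp
  map_add' M N := by simp [add_smul, Finset.sum_add_distrib]
  commutes' c := by
    rw [Algebra.algebraMap_eq_smul_one (A := B), ← hone, Finset.smul_sum]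
    exact Finset.sum_congr rfl fun s _ => by
      simp [Algebra.algebraMap_eq_smul_one, one_apply, ite_smul]
  map_star' M := by
    simp only [star_sum, star_smul, hstar, star_eq_conjTranspose, conjTranspose_apply]
    exact Finset.sum_comm

end MatrixUnits

variable {d : ℕ}

theorem site_commute_elemTensor {j k : ℤ} (h : j < k) (A : Matrix (Fin d) (Fin d) ℂ)
    (l : List (Matrix (Fin d) (Fin d) ℂ)) : Commute (site j A) (elemTensor k l) := by
  induction l generalizing k with
  | nil => exact Commute.one_right _
  | cons B l ih => exact (site_commute h.ne A B).mul_right (ih (h.trans (lt_add_one k)))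

/-- The matrix unit `⨂ E_{s_i t_i}` at the sites `k, …, k + n - 1`. -/
def unitTensor (k : ℤ) {n : ℕ} (s t : Fin n → Fin d) : UHF d :=
  elemTensor k (List.ofFn fun i => single (s i) (t i) 1)

theorem unitTensor_succ (k : ℤ) {n : ℕ} (s t : Fin (n + 1) → Fin d) :
    unitTensor k s t = site k (single (s 0) (t 0) 1) *
      unitTensor (k + 1) (fun i => s i.succ) (fun i => t i.succ) := by
  rw [unitTensor, List.ofFn_succ]
  rfl

theorem unitTensor_mul (k : ℤ) {n : ℕ} (s t s' t' : Fin n → Fin d) :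
    unitTensor k s t * unitTensor k s' t' = if t = s' then unitTensor k s t' else 0 := by
  induction n generalizing k with
  | zero =>
    rw [if_pos (Subsingleton.elim _ _)]
    simp [unitTensor, elemTensor]
  | succ n ih =>
    have hc : Commute (unitTensor (k + 1) (fun i => s i.succ) (fun i => t i.succ))
        (site k (single (s' 0) (t' 0) 1)) :=
      (site_commute_elemTensor (lt_add_one k) _ _).symm
    rw [unitTensor_succ, unitTensor_succ, hc.mul_mul_mul_comm, ← map_mul, ih]
    have hiff : t = s' ↔ t 0 = s' 0 ∧ (fun i : Fin n => t i.succ) = fun i => s' i.succ := by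
      simp only [funext_iff, Fin.forall_fin_succ]
    by_cases h0 : t 0 = s' 0
    · by_cases h1 : (fun i : Fin n => t i.succ) = fun i => s' i.succ
      · rw [if_pos h1, if_pos (hiff.2 ⟨h0, h1⟩), unitTensor_succ, h0,
          single_mul_single_same, mul_one]
      · rw [if_neg h1, if_neg fun h => h1 (hiff.1 h).2, mul_zero]
    · rw [if_neg fun h => h0 (hiff.1 h).1, single_mul_single_of_ne _ _ _ _ h0, map_zero, zero_mul]

theorem star_unitTensor (k : ℤ) {n : ℕ} (s t : Fin n → Fin d) :
    star (unitTensor k s t) = unitTensor k t s := by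
  induction n generalizing k with
  | zero => simp [unitTensor, elemTensor]
  | succ n ih =>
    rw [unitTensor_succ, unitTensor_succ, star_mul, ih, ← map_star, star_eq_conjTranspose,
      conjTranspose_single, star_one]
    exact (site_commute_elemTensor (lt_add_one k) _ _).symm

theorem sum_fin_succ {n : ℕ} {M : Type*} [AddCommMonoid M] (f : (Fin (n + 1) → Fin d) → M) :
    ∑ s, f s = ∑ a, ∑ s : Fin n → Fin d, f (Fin.cons a s) := by
  rw [← (Fin.consEquiv fun _ => Fin d).sum_comp, Fintype.sum_prod_type]
  rfl

theorem sum_unitTensor (k : ℤ) (n : ℕ) : ∑ s : Fin n → Fin d, unitTensor k s s = 1 := by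
  induction n generalizing k with
  | zero => simp [unitTensor, elemTensor]
  | succ n ih =>
    rw [sum_fin_succ]
    simp only [unitTensor_succ, Fin.cons_zero, Fin.cons_succ, ← Finset.mul_sum, ih, mul_one]
    rw [← map_sum, sum_single_one, map_one]

/-- The representation of a matrix algebra as the local algebra of the sites `k, …, k + n - 1`. -/
def localHom (d : ℕ) (k : ℤ) (n : ℕ) :
    Matrix (Fin n → Fin d) (Fin n → Fin d) ℂ →⋆ₐ[ℂ] UHF d :=
  matrixUnitHom (unitTensor k) (unitTensor_mul k) (star_unitTensor k) (sum_unitTensor k n)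

theorem localHom_apply (k : ℤ) {n : ℕ} (M : Matrix (Fin n → Fin d) (Fin n → Fin d) ℂ) :
    localHom d k n M = ∑ s, ∑ t, M s t • unitTensor k s t := rfl

/-- A nonempty full matrix algebra is simple. -/
theorem localHom_injective [Nontrivial (UHF d)] [NeZero d] (k : ℤ) (n : ℕ) :
    Function.Injective (localHom d k n) :=
  (localHom d k n : Matrix (Fin n → Fin d) (Fin n → Fin d) ℂ →+* UHF d).injective

theorem site_eq_sum (k : ℤ) (A : Matrix (Fin d) (Fin d) ℂ) :
    site k A = ∑ a, ∑ b, A a b • site k (single a b 1) := by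
  conv_lhs => rw [matrix_eq_sum_single A]
  simp only [map_sum, ← map_smul, smul_single, smul_eq_mul, mul_one]

/-- Splits off the first site; inductions on the length of the interval rest on it. -/
theorem localHom_succ (k : ℤ) {n : ℕ} (A : Matrix (Fin d) (Fin d) ℂ)
    (M : Matrix (Fin n → Fin d) (Fin n → Fin d) ℂ) :
    localHom d k (n + 1) (of fun s t => A (s 0) (t 0) * M (fun i => s i.succ) fun i => t i.succ) =
      site k A * localHom d (k + 1) n M := by
  have h : ∀ f : (Fin (n + 1) → Fin d) → UHF d,
    ∑ s, f s = ∑ a, ∑ s : Fin n → Fin d, f (Fin.cons a s) := sum_fin_succ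
  rw [localHom_apply, localHom_apply, site_eq_sum]
  simp only [h, Finset.sum_mul, Finset.mul_sum, smul_mul_smul_comm, of_apply,
    unitTensor_succ, Fin.cons_zero, Fin.cons_succ]
  rw [Finset.sum_comm]
  refine Finset.sum_congr rfl fun s _ => ?_
  conv_rhs => rw [Finset.sum_comm]
  exact Finset.sum_congr rfl fun a _ => Finset.sum_comm

theorem localHom_prod (k : ℤ) {n : ℕ} (A : Fin n → Matrix (Fin d) (Fin d) ℂ) :
    localHom d k n (of fun s t => ∏ i, A i (s i) (t i)) = elemTensor k (List.ofFn A) := by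
  induction n generalizing k with
  | zero =>
    rw [show (of fun s t : Fin 0 → Fin d => ∏ i, A i (s i) (t i)) = 1 by
      ext s t; rw [Subsingleton.elim s t]; simp, map_one]
    simp [elemTensor]
  | succ n ih =>
    simp only [Fin.prod_univ_succ, List.ofFn_succ, elemTensor]
    rw [← ih, ← localHom_succ]
    rfl

theorem elemTensor_mem_localAlg (k : ℤ) (l : List (Matrix (Fin d) (Fin d) ℂ)) (Λ : Finset ℤ)
    (hΛ : Finset.Ico k (k + l.length) ⊆ Λ) : elemTensor k l ∈ localAlg d Λ := by
  induction l generalizing k with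
  | nil => exact one_mem _
  | cons A l ih =>
    simp only [List.length_cons, Nat.cast_add, Nat.cast_one] at hΛ
    refine mul_mem (StarAlgebra.subset_adjoin ℂ _ ?_) (ih _ fun i hi => hΛ ?_)
    · exact Set.mem_biUnion (hΛ (by simp)) ⟨A, rfl⟩
    · simp only [Finset.mem_Ico] at hi ⊢
      omega

theorem site_mem_range_localHom {j k : ℤ} {n : ℕ} (hk : k ≤ j) (hj : j < k + n)
    (A : Matrix (Fin d) (Fin d) ℂ) : site j A ∈ (localHom d k n).range := by
  induction n generalizing k with
  | zero => simp at hj; omega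
  | succ n ih =>
    rcases hk.eq_or_lt with rfl | hk'
    · exact ⟨_, (localHom_succ k A 1).trans (by rw [map_one, mul_one])⟩
    · obtain ⟨M, hM⟩ := ih (k := k + 1) hk' (by push_cast at hj; omega)
      refine ⟨_, (localHom_succ k 1 M).trans ?_⟩
      rw [map_one, one_mul]
      exact hM

theorem localAlg_eq_range (k : ℤ) (n : ℕ) :
    localAlg d (Finset.Ico k (k + n)) = (localHom d k n).range := by
  refine le_antisymm (StarAlgebra.adjoin_le ?_) ?_
  · intro x hx
    simp only [Set.mem_iUnion] at hx
    obtain ⟨i, hi, A, rfl⟩ := hx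
    rw [Finset.mem_Ico] at hi
    exact site_mem_range_localHom hi.1 hi.2 A
  · rintro _ ⟨M, rfl⟩
    change localHom d k n M ∈ _
    rw [localHom_apply]
    exact sum_mem fun s _ => sum_mem fun t _ => SMulMemClass.smul_mem _
      (elemTensor_mem_localAlg _ _ _ (by rw [List.length_ofFn]))

theorem coe_tensorPower_Ico (g : Matrix.unitaryGroup (Fin d) ℂ) (k : ℤ) (n : ℕ) :
    (tensorPower g (Finset.Ico k (k + n)) : UHF d) =
      localHom d k n (of fun s t => ∏ i, g.1 (s i) (t i)) := by
  rw [localHom_prod k fun _ => g.1]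
  induction n generalizing k with
  | zero => simp [tensorPower, elemTensor]
  | succ n ih =>
    have h : Finset.Ico k (k + (n + 1 : ℕ)) = insert k (Finset.Ico (k + 1) (k + 1 + n)) := by
      ext j
      simp only [Finset.mem_Ico, Finset.mem_insert]
      push_cast
      omega
    rw [List.ofFn_succ, elemTensor, ← ih, h, tensorPower]
    exact congrArg Subtype.val (Finset.noncommProd_insert_of_notMem _ _ _ _ (by simp))

/-! ### Permutation operators and their commutant -/

section Permutation

variable {n : ℕ}

/-- The operator that permutes the tensor components of `⨂_{i < n} ℂ^d`. -/
def permOp (d : ℕ) {n : ℕ} (σ : Equiv.Perm (Fin n)) :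
    Matrix (Fin n → Fin d) (Fin n → Fin d) ℂ :=
  (σ.arrowCongr (Equiv.refl (Fin d))).toPEquiv.toMatrix

/-- Used in two ways: to show that permutations commute with `g ⊗ ⋯ ⊗ g`, and to describe their
commutant. -/
theorem permOp_mul_eq_iff (σ : Equiv.Perm (Fin n)) (M : Matrix (Fin n → Fin d) (Fin n → Fin d) ℂ) :
    permOp d σ * M = M * permOp d σ ↔ ∀ s t, M (s ∘ σ) (t ∘ σ) = M s t := by
  rw [permOp, PEquiv.toMatrix_toPEquiv_mul, PEquiv.mul_toMatrix_toPEquiv]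
  constructor
  · intro h s t
    have := congrFun (congrFun h (s ∘ σ)) t
    simp only [submatrix_apply, id_eq] at this
    have e1 : (σ.arrowCongr (Equiv.refl (Fin d))) (s ∘ σ) = s := by
      ext i; simp [Equiv.arrowCongr]
    have e2 : (σ.arrowCongr (Equiv.refl (Fin d))).symm t = t ∘ σ := by
      ext i; simp [Equiv.arrowCongr]
    rw [e1, e2] at this
    exact this.symm
  · intro h
    ext s t
    simp only [submatrix_apply, id_eq]
    rw [← h]
    congr 1
    · ext i; simp [Equiv.arrowCongr]

/-- The number of sites at which a pair of configurations takes a given value. -/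
def pairCount (p : (Fin n → Fin d) × (Fin n → Fin d)) : Fin d × Fin d → Fin (n + 1) := fun a =>
  ⟨Fintype.card {i // (p.1 i, p.2 i) = a},
    Nat.lt_succ_of_le ((Fintype.card_subtype_le _).trans (Fintype.card_fin n).le)⟩

/-- Equal counts mean that corresponding fibres have equal size; bijections of the fibres glue to a
permutation of the sites. -/
theorem exists_perm_of_pairCount_eq {p q : (Fin n → Fin d) × (Fin n → Fin d)}
    (h : pairCount p = pairCount q) : ∃ σ : Equiv.Perm (Fin n), p.1 = q.1 ∘ σ ∧ p.2 = q.2 ∘ σ := by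
  have e : ∀ a, Nonempty ({i // (p.1 i, p.2 i) = a} ≃ {i // (q.1 i, q.2 i) = a}) := fun a =>
    Fintype.card_eq.1 (Fin.mk.inj (congrFun h a))
  let σ : Fin n ≃ Fin n := Equiv.ofFiberEquiv (f := fun i => (p.1 i, p.2 i))
    (g := fun i => (q.1 i, q.2 i)) fun a => (e a).some
  have hσ : ∀ i, (q.1 (σ i), q.2 (σ i)) = (p.1 i, p.2 i) :=
    Equiv.ofFiberEquiv_map (f := fun i => (p.1 i, p.2 i)) (g := fun i => (q.1 i, q.2 i)) _
  exact ⟨σ, funext fun i => (congrArg Prod.fst (hσ i)).symm,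
    funext fun i => (congrArg Prod.snd (hσ i)).symm⟩

/-- The commutant of the permutation operators has polynomial dimension. -/
theorem finrank_centralizer_le {S : Set (Matrix (Fin n → Fin d) (Fin n → Fin d) ℂ)}
    (hS : ∀ σ, permOp d σ ∈ S) :
    Module.finrank ℂ (Subalgebra.centralizer ℂ S) ≤ (n + 1) ^ (d * d) := by
  -- The commutant lies in the space of matrices whose entries depend only on the counts: `d²`
  -- counts, each with `n + 1` possible values.
  let Φ : ((Fin d × Fin d → Fin (n + 1)) → ℂ) →ₗ[ℂ]
      Matrix (Fin n → Fin d) (Fin n → Fin d) ℂ :=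
    { toFun := fun f => of fun s t => f (pairCount (s, t))
      map_add' := fun f g => rfl
      map_smul' := fun c f => rfl }
  have hle : (Subalgebra.centralizer ℂ S).toSubmodule ≤ LinearMap.range Φ := by
    intro T hT
    rw [Subalgebra.mem_toSubmodule, Subalgebra.mem_centralizer_iff] at hT
    have hf : Function.FactorsThrough (fun p : (Fin n → Fin d) × (Fin n → Fin d) => T p.1 p.2)
        pairCount := by
      intro p q hpq
      obtain ⟨σ, h1, h2⟩ := exists_perm_of_pairCount_eq hpq
      simp only
      rw [h1, h2]
      exact (permOp_mul_eq_iff σ T).1 (hT _ (hS σ)) _ _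
    refine ⟨Function.extend pairCount (fun p => T p.1 p.2) 0, ?_⟩
    ext s t
    exact hf.extend_apply 0 (s, t)
  calc Module.finrank ℂ (Subalgebra.centralizer ℂ S)
      ≤ Module.finrank ℂ (LinearMap.range Φ) := Submodule.finrank_mono hle
    _ ≤ Module.finrank ℂ ((Fin d × Fin d → Fin (n + 1)) → ℂ) := LinearMap.finrank_range_le Φ
    _ = (n + 1) ^ (d * d) := by simp

end Permutation

/-- The entry `∏ g (s i) (t i)` of `g ⊗ ⋯ ⊗ g` is unchanged when `s` and `t` are permuted
simultaneously. -/
theorem localHom_permOp_mem_invariantAlg {n : ℕ} (G : Subgroup (Matrix.unitaryGroup (Fin d) ℂ))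
    (k : ℤ) (σ : Equiv.Perm (Fin n)) :
    localHom d k n (permOp d σ) ∈ invariantAlg G (Finset.Ico k (k + n)) := by
  simp only [invariantAlg, StarSubalgebra.mem_inf, StarSubalgebra.mem_iInf]
  refine ⟨localAlg_eq_range (d := d) k n ▸ ⟨_, rfl⟩, fun g _ => ?_⟩
  rw [StarAlgHom.mem_equalizer]
  change (tensorPower g (Finset.Ico k (k + n)) : UHF d) * localHom d k n (permOp d σ) *
    star (tensorPower g (Finset.Ico k (k + n)) : UHF d) = localHom d k n (permOp d σ)
  have h : (tensorPower g (Finset.Ico k (k + n)) : UHF d) * localHom d k n (permOp d σ) =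
      localHom d k n (permOp d σ) * (tensorPower g (Finset.Ico k (k + n)) : UHF d) := by
    rw [coe_tensorPower_Ico, ← map_mul, ← map_mul, (permOp_mul_eq_iff σ _).2]
    intro s t
    simp only [of_apply, Function.comp_apply]
    exact Equiv.prod_comp σ fun i => g.1 (s i) (t i)
  rw [h, mul_assoc, Unitary.mul_star_self_of_mem (tensorPower g _).2, mul_one]

/-! ### The densities of a state of the UHF algebra -/

/-- The density matrix of the restriction of `φ` to the sites `k, …, k + n - 1`. -/
def stateMatrix (φ : UHF d →ₗ[ℂ] ℂ) (k : ℤ) (n : ℕ) :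
    Matrix (Fin n → Fin d) (Fin n → Fin d) ℂ :=
  of fun s t => φ (unitTensor k t s)

theorem trace_stateMatrix_mul (φ : UHF d →ₗ[ℂ] ℂ) (k : ℤ) {n : ℕ}
    (M : Matrix (Fin n → Fin d) (Fin n → Fin d) ℂ) :
    (stateMatrix φ k n * M).trace = φ (localHom d k n M) := by
  rw [localHom_apply]
  simp only [map_sum, map_smul, trace, diag_apply, mul_apply, stateMatrix, of_apply, smul_eq_mul]
  rw [Finset.sum_comm]
  exact Finset.sum_congr rfl fun _ _ => Finset.sum_congr rfl fun _ _ => mul_comm _ _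

theorem IsState.trace_stateMatrix {φ : UHF d →ₗ[ℂ] ℂ} (hφ : IsState φ) (k : ℤ) (n : ℕ) :
    (stateMatrix φ k n).trace = 1 := by
  rw [← Matrix.mul_one (stateMatrix φ k n), trace_stateMatrix_mul, _root_.map_one, hφ.map_one]

theorem IsState.posSemidef_stateMatrix {φ : UHF d →ₗ[ℂ] ℂ} (hφ : IsState φ) (k : ℤ) (n : ℕ) :
    (stateMatrix φ k n).PosSemidef := by
  have h : ∀ x : (Fin n → Fin d) → ℂ, 0 ≤ star x ⬝ᵥ (stateMatrix φ k n *ᵥ x) := by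
    intro x
    rcases isEmpty_or_nonempty (Fin n → Fin d) with hX | ⟨⟨s₀⟩⟩
    · simp [dotProduct]
    -- A rank-one `R` with `R* R = |x⟩⟨x|` turns the quadratic form at `x` into the value of the
    -- state at a positive element.
    · set R := vecMulVec (Pi.single s₀ (1 : ℂ)) (star x)
      have h1 : star R * R = vecMulVec x (star x) := by
        rw [star_eq_conjTranspose, conjTranspose_vecMulVec, star_star, vecMulVec_mul_vecMulVec]
        simp
      have h2 : star x ⬝ᵥ (stateMatrix φ k n *ᵥ x) = φ (localHom d k n (star R * R)) := by
        rw [h1, ← trace_stateMatrix_mul, mul_vecMulVec, trace_vecMulVec, dotProduct_comm]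
      rw [h2, map_mul, map_star]
      exact hφ.nonneg _
  -- Over `ℂ` a nonnegative quadratic form is enough; hermiticity comes for free.
  rw [← isPositive_toEuclideanLin_iff, LinearMap.isPositive_iff_complex]
  intro x
  have h2 := Complex.nonneg_iff.1 (h x.ofLp)
  have h3 : inner ℂ ((stateMatrix φ k n).toEuclideanLin x) x =
      star (star x.ofLp ⬝ᵥ (stateMatrix φ k n *ᵥ x.ofLp)) := by
    rw [EuclideanSpace.inner_eq_star_dotProduct, star_dotProduct, star_star, dotProduct_comm]
    rfl
  rw [h3]
  have h4 : star x.ofLp ⬝ᵥ (stateMatrix φ k n *ᵥ x.ofLp) =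
      ((star x.ofLp ⬝ᵥ (stateMatrix φ k n *ᵥ x.ofLp)).re : ℂ) :=
    Complex.ext (by simp) (by simpa using h2.2.symm)
  rw [h4]
  simpa using h2.1

/-! ### Subadditivity of the entropy over adjacent intervals -/

theorem elemTensor_append (k : ℤ) (l l' : List (Matrix (Fin d) (Fin d) ℂ)) :
    elemTensor k (l ++ l') = elemTensor k l * elemTensor (k + l.length) l' := by
  induction l generalizing k with
  | nil => simp [elemTensor]
  | cons A l ih =>
    rw [List.cons_append, elemTensor, elemTensor, ih, mul_assoc, List.length_cons]
    push_cast
    rw [add_assoc, add_comm (1 : ℤ)]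

theorem unitTensor_append (k : ℤ) {m n : ℕ} (s t : Fin m → Fin d) (s' t' : Fin n → Fin d) :
    unitTensor k (Fin.append s s') (Fin.append t t') =
      unitTensor k s t * unitTensor (k + m) s' t' := by
  have h : (fun i => single (Fin.append s s' i) (Fin.append t t' i) (1 : ℂ)) =
      Fin.append (fun i => single (s i) (t i) 1) (fun i => single (s' i) (t' i) 1) := by
    ext1 i
    refine Fin.addCases (fun i => ?_) (fun i => ?_) i <;> simp
  rw [unitTensor, h, List.ofFn_fin_append, elemTensor_append, List.length_ofFn]
  rfl

theorem sum_fin_add {m n : ℕ} {M : Type*} [AddCommMonoid M] (f : (Fin (m + n) → Fin d) → M) :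
    ∑ s, f s = ∑ a : Fin m → Fin d, ∑ b : Fin n → Fin d, f (Fin.append a b) := by
  rw [← (Fin.appendEquiv m n).sum_comp, Fintype.sum_prod_type]
  rfl

/-- The Kronecker product of matrices indexed by configurations. -/
def appendKronecker {m n : ℕ} (M : Matrix (Fin m → Fin d) (Fin m → Fin d) ℂ)
    (N : Matrix (Fin n → Fin d) (Fin n → Fin d) ℂ) :
    Matrix (Fin (m + n) → Fin d) (Fin (m + n) → Fin d) ℂ :=
  of fun s t => M (fun i => s (Fin.castAdd n i)) (fun i => t (Fin.castAdd n i)) *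
    N (fun i => s (Fin.natAdd m i)) (fun i => t (Fin.natAdd m i))

theorem localHom_appendKronecker (k : ℤ) {m n : ℕ}
    (M : Matrix (Fin m → Fin d) (Fin m → Fin d) ℂ)
    (N : Matrix (Fin n → Fin d) (Fin n → Fin d) ℂ) :
    localHom d k (m + n) (appendKronecker M N) = localHom d k m M * localHom d (k + m) n N := by
  have h : ∀ f : (Fin (m + n) → Fin d) → UHF d,
    ∑ s, f s = ∑ a : Fin m → Fin d, ∑ b : Fin n → Fin d, f (Fin.append a b) := sum_fin_add
  rw [localHom_apply, localHom_apply, localHom_apply]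
  simp only [h, unitTensor_append, appendKronecker, of_apply, Fin.append_left, Fin.append_right,
    ← smul_mul_smul_comm, ← Finset.mul_sum, ← Finset.sum_mul]

/-- Measuring in the product of the eigenbases of the two marginal densities cannot lower the
entropy (Schur's inequality). The outcome is a classical joint distribution whose marginals are the
two spectra, so Shannon subadditivity finishes. -/
theorem spectralEntropy_stateMatrix_add_le {φ : UHF d →ₗ[ℂ] ℂ} (hφ : IsState φ) (k : ℤ)
    (m n : ℕ) : spectralEntropy (stateMatrix φ k (m + n)) ≤
      spectralEntropy (stateMatrix φ k m) + spectralEntropy (stateMatrix φ (k + m) n) := by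
  have hD := hφ.posSemidef_stateMatrix k (m + n)
  have h1 := (hφ.posSemidef_stateMatrix k m).isHermitian
  have h2 := (hφ.posSemidef_stateMatrix (k + m) n).isHermitian
  set l₁ := h1.eigenvalues
  set l₂ := h2.eigenvalues
  set U₁ : Matrix (Fin m → Fin d) (Fin m → Fin d) ℂ := h1.eigenvectorUnitary.1
  set U₂ : Matrix (Fin n → Fin d) (Fin n → Fin d) ℂ := h2.eigenvectorUnitary.1
  have hU₁ : U₁ * U₁ᴴ = 1 := eigenvectorUnitary_mul_conjTranspose h1
  have hU₂ : U₂ * U₂ᴴ = 1 := eigenvectorUnitary_mul_conjTranspose h2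
  let P : ∀ {n : ℕ} (U : Matrix (Fin n → Fin d) (Fin n → Fin d) ℂ) (a : Fin n → Fin d),
    Matrix (Fin n → Fin d) (Fin n → Fin d) ℂ := fun U a => of fun s t => U s a * star (U t a)
  have hP : ∀ {n : ℕ} (U : Matrix (Fin n → Fin d) (Fin n → Fin d) ℂ), U * Uᴴ = 1 →
      ∑ a, P U a = 1 := by
    intro n U hU
    rw [← hU]
    ext s t
    rw [Matrix.sum_apply, mul_apply]
    rfl
  have hPtr : ∀ {n : ℕ} (U D : Matrix (Fin n → Fin d) (Fin n → Fin d) ℂ) a,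
      (D * P U a).trace = (Uᴴ * D * U) a a := by
    intro n U D a
    simp only [trace, diag_apply, mul_apply, P, of_apply, conjTranspose_apply, Finset.sum_mul]
    rw [Finset.sum_comm]
    exact Finset.sum_congr rfl fun _ _ => Finset.sum_congr rfl fun _ _ => by ring
  let V : Matrix (Fin (m + n) → Fin d) ((Fin m → Fin d) × (Fin n → Fin d)) ℂ := of fun s c =>
    U₁ (fun i => s (Fin.castAdd n i)) c.1 * U₂ (fun i => s (Fin.natAdd m i)) c.2
  have hV : V * Vᴴ = 1 := by
    ext s t
    have e1 := congrFun (congrFun hU₁ fun i => s (Fin.castAdd n i)) fun i => t (Fin.castAdd n i)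
    have e2 := congrFun (congrFun hU₂ fun i => s (Fin.natAdd m i)) fun i => t (Fin.natAdd m i)
    rw [mul_apply] at e1 e2 ⊢
    have e3 : ∑ c, V s c * Vᴴ c t = (1 : Matrix (Fin m → Fin d) (Fin m → Fin d) ℂ)
        (fun i => s (Fin.castAdd n i)) (fun i => t (Fin.castAdd n i)) *
        (1 : Matrix (Fin n → Fin d) (Fin n → Fin d) ℂ) (fun i => s (Fin.natAdd m i))
          (fun i => t (Fin.natAdd m i)) := by
      rw [← e1, ← e2, Finset.sum_mul_sum, Fintype.sum_prod_type]
      refine Finset.sum_congr rfl fun a _ => Finset.sum_congr rfl fun b _ => ?_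
      simp only [V, conjTranspose_apply, of_apply, star_mul']
      ring
    rw [e3]
    simp only [one_apply, ite_mul, one_mul, zero_mul, ← ite_and]
    refine if_congr ?_ rfl rfl
    simp only [funext_iff]
    exact ⟨fun h i => Fin.addCases h.1 h.2 i, fun h => ⟨fun i => h _, fun i => h _⟩⟩
  have hdiag : ∀ a b, (Vᴴ * stateMatrix φ k (m + n) * V) (a, b) (a, b) =
      φ (localHom d k m (P U₁ a) * localHom d (k + m) n (P U₂ b)) := by
    intro a b
    rw [← localHom_appendKronecker, ← trace_stateMatrix_mul]
    simp only [trace, diag_apply, mul_apply, P, of_apply, conjTranspose_apply, Finset.sum_mul, V,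
      appendKronecker, star_mul']
    rw [Finset.sum_comm]
    exact Finset.sum_congr rfl fun _ _ => Finset.sum_congr rfl fun _ _ => by ring
  let p : (Fin m → Fin d) → (Fin n → Fin d) → ℝ := fun a b =>
    (φ (localHom d k m (P U₁ a) * localHom d (k + m) n (P U₂ b))).re
  have hp0 : ∀ a b, 0 ≤ p a b := fun a b => by
    have := (Complex.nonneg_iff.1 ((hD.conjTranspose_mul_mul_same V).diag_nonneg (i := (a, b)))).1
    rwa [hdiag] at this
  have hpa : ∀ a, ∑ b, p a b = l₁ a := by
    intro a
    simp only [p]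
    rw [← Complex.re_sum, ← map_sum, ← Finset.mul_sum, ← map_sum, hP U₂ hU₂, map_one, mul_one,
      ← trace_stateMatrix_mul, hPtr]
    have := congrFun (congrFun (eigenvectorUnitary_conj h1) a) a
    rw [diagonal_apply_eq] at this
    exact (congrArg Complex.re this).trans (Complex.ofReal_re _)
  have hpb : ∀ b, ∑ a, p a b = l₂ b := by
    intro b
    simp only [p]
    rw [← Complex.re_sum, ← map_sum, ← Finset.sum_mul, ← map_sum, hP U₁ hU₁, map_one, one_mul,
      ← trace_stateMatrix_mul, hPtr]
    have := congrFun (congrFun (eigenvectorUnitary_conj h2) b) b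
    rw [diagonal_apply_eq] at this
    exact (congrArg Complex.re this).trans (Complex.ofReal_re _)
  have hsum : ∑ a, ∑ b, p a b = 1 := by
    simp only [hpa]
    have := h1.trace_eq_sum_eigenvalues
    rw [hφ.trace_stateMatrix] at this
    exact Complex.ofReal_injective (by push_cast; exact this.symm)
  have h3 := spectralEntropy_le_of_mul_conjTranspose_eq_one hD V hV
  have h4 := sum_negMulLog_le_marginals p hp0 hsum
  simp only [hpa, hpb] at h4
  rw [Fintype.sum_prod_type] at h3
  simp only [hdiag] at h3
  rw [spectralEntropy_eq_sum h1, spectralEntropy_eq_sum h2]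
  exact h3.trans h4

/-! ### Mean entropies -/

section MeanEntropy

/-- Since the local algebra is a copy of a matrix algebra, any map into it becomes a
finite-dimensional representation. -/
theorem exists_lift_localHom {A : Type*} [Ring A] [StarRing A] [Algebra ℂ A] {k : ℤ} {n : ℕ}
    (hinj : Function.Injective (localHom d k n)) (j : A →⋆ₐ[ℂ] UHF d)
    (hj : ∀ a, j a ∈ (localHom d k n).range) :
    ∃ π : A →⋆ₐ[ℂ] Matrix (Fin n → Fin d) (Fin n → Fin d) ℂ, ∀ a, localHom d k n (π a) = j a := by
  let e := StarAlgEquiv.ofInjective (localHom d k n) hinj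
  refine ⟨(e.symm : (localHom d k n).range →⋆ₐ[ℂ] _).comp (j.codRestrict _ hj), fun a => ?_⟩
  exact congrArg Subtype.val (e.apply_symm_apply (j.codRestrict _ hj a))

theorem IsState.nontrivial {φ : UHF d →ₗ[ℂ] ℂ} (hφ : IsState φ) : Nontrivial (UHF d) :=
  ⟨0, 1, fun h => by simpa [← h] using hφ.map_one⟩

/-- For `d = 0` the unit of a site is zero, and no state exists. -/
theorem IsState.neZero {φ : UHF d →ₗ[ℂ] ℂ} (hφ : IsState φ) : NeZero d := by
  refine ⟨?_⟩
  rintro rfl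
  have := hφ.nontrivial
  refine one_ne_zero (α := UHF 0) ?_
  rw [← _root_.map_one (site 0), Subsingleton.elim (1 : Matrix (Fin 0) (Fin 0) ℂ) 0, map_zero]

/-- Along subalgebras of the local algebras that contain the permutation operators, the entropy
of the restricted state has the same asymptotics as the entropy of the state itself. -/
theorem hasMeanEntropy_of_permOp_mem {B : Type*} [Ring B] [StarRing B] [Algebra ℂ B]
    [StarModule ℂ B] {φ : UHF d →ₗ[ℂ] ℂ} (hφ : IsState φ) (ι : B →⋆ₐ[ℂ] UHF d)
    (hι : Function.Injective ι) (F : ℕ → StarSubalgebra ℂ B)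
    (hF : ∀ n, ∀ b ∈ F n, ι b ∈ (localHom d 1 n).range)
    (hperm : ∀ n σ, ∃ b ∈ F n, ι b = localHom d 1 n (permOp d σ))
    (ψ : B →ₗ[ℂ] ℂ) (hψ : ∀ b, ψ b = φ (ι b)) {s : ℝ}
    (hs : Tendsto (fun n : ℕ => spectralEntropy (stateMatrix φ 1 n) / n) atTop (𝓝 s)) :
    HasMeanEntropy F ψ s := by
  have := hφ.nontrivial
  have := hφ.neZero
  have hinj : ∀ n, Function.Injective (localHom d 1 n) := localHom_injective 1
  choose π hπ using fun n => exists_lift_localHom (hinj n) (ι.comp (F n).subtype)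
    fun b => hF n b b.2
  refine ⟨fun n => BlockDecomposition.nonempty_of_injective (π n) fun a b hab => ?_, fun P => ?_⟩
  · apply Subtype.ext
    apply hι
    exact (hπ n a).symm.trans ((congrArg _ hab).trans (hπ n b))
  · have hbound : ∀ n, |(P n).entropy (ψ ∘ₗ (F n).subtype.toAlgHom.toLinearMap) -
        spectralEntropy (stateMatrix φ 1 n)| ≤ (d * d : ℕ) * Real.log (n + 1) := by
      intro n
      have h := abs_entropy_sub_spectralEntropy_le (P n) (π n) (hφ.posSemidef_stateMatrix 1 n)
        (hφ.trace_stateMatrix 1 n) (ψ ∘ₗ (F n).subtype.toAlgHom.toLinearMap)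
        (fun a => by
          rw [trace_stateMatrix_mul, hπ]
          exact hψ a)
        (K := (n + 1) ^ (d * d)) (Nat.one_le_pow _ _ n.succ_pos)
        (finrank_centralizer_le fun σ => by
          obtain ⟨b, hb, hbσ⟩ := hperm n σ
          exact ⟨⟨b, hb⟩, hinj n ((hπ n _).trans hbσ)⟩)
      rw [Nat.cast_pow, Real.log_pow] at h
      exact_mod_cast h
    have hlog : Tendsto (fun n : ℕ => (d * d : ℕ) * Real.log (n + 1) / n) atTop (𝓝 0) := by
      -- The limit of `log x / (x - 1)` taken along `x = n + 1`; the shift `-1` restores the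
      -- denominator `n`.
      have h := (Real.tendsto_pow_log_div_mul_add_atTop 1 (-1) 1 one_ne_zero).comp
        (tendsto_natCast_atTop_atTop.comp (tendsto_add_atTop_nat 1))
      have h2 := h.const_mul ((d * d : ℕ) : ℝ)
      rw [mul_zero] at h2
      refine h2.congr fun n => ?_
      simp only [Function.comp_apply, pow_one, one_mul, Nat.cast_add, Nat.cast_one]
      rw [add_neg_cancel_right, mul_div_assoc]
    have hdiff : Tendsto (fun n : ℕ => ((P n).entropy (ψ ∘ₗ (F n).subtype.toAlgHom.toLinearMap) -
        spectralEntropy (stateMatrix φ 1 n)) / n) atTop (𝓝 0) := by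
      refine squeeze_zero_norm (fun n => ?_) hlog
      rw [norm_div, Real.norm_eq_abs, Real.norm_natCast]
      gcongr
      exact hbound n
    have h := hdiff.add hs
    rw [zero_add] at h
    exact h.congr fun n => by rw [← add_div, sub_add_cancel]

/-- Translation invariance: the value on an elementary tensor depends only on the list of factors.
-/
theorem IsFinitelyCorrelated.stateMatrix_eq
    {E : Matrix (Fin d × Fin d) (Fin d × Fin d) ℂ →CP Matrix (Fin d) (Fin d) ℂ}
    {ρ : Matrix (Fin d) (Fin d) ℂ →ₗ[ℂ] ℂ} {φ : UHF d →ₗ[ℂ] ℂ} (h : IsFinitelyCorrelated E ρ φ)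
    (k k' : ℤ) (n : ℕ) : stateMatrix φ k n = stateMatrix φ k' n := by
  ext s t
  exact (h.apply_elemTensor k _).trans (h.apply_elemTensor k' _).symm

/-- Fekete's lemma: translation invariance turns subadditivity over adjacent intervals into
subadditivity in the length, and nonnegativity keeps the limit finite. -/
theorem IsFinitelyCorrelated.exists_tendsto
    {E : Matrix (Fin d × Fin d) (Fin d × Fin d) ℂ →CP Matrix (Fin d) (Fin d) ℂ}
    {ρ : Matrix (Fin d) (Fin d) ℂ →ₗ[ℂ] ℂ} {φ : UHF d →ₗ[ℂ] ℂ} (h : IsFinitelyCorrelated E ρ φ) :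
    ∃ s : ℝ, Tendsto (fun n : ℕ => spectralEntropy (stateMatrix φ 1 n) / n) atTop (𝓝 s) := by
  have hsub : Subadditive fun n : ℕ => spectralEntropy (stateMatrix φ 1 n) := fun m n => by
    have := spectralEntropy_stateMatrix_add_le h.isState 1 m n
    rwa [h.stateMatrix_eq (1 + m) 1] at this
  refine ⟨hsub.lim, hsub.tendsto_lim ⟨0, ?_⟩⟩
  rintro _ ⟨n, rfl⟩
  exact div_nonneg (spectralEntropy_nonneg (h.isState.posSemidef_stateMatrix 1 n)
    (h.isState.trace_stateMatrix 1 n)) n.cast_nonneg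

end MeanEntropy

end QChain

end

theorem mainTheorem2 (d : ℕ) (G : Subgroup (Matrix.unitaryGroup (Fin d) ℂ))
    (E : Matrix (Fin d × Fin d) (Fin d × Fin d) ℂ →CP Matrix (Fin d) (Fin d) ℂ)
    (ρ : Matrix (Fin d) (Fin d) ℂ →ₗ[ℂ] ℂ)
    (φt : QChain.UHF d →ₗ[ℂ] ℂ) (φ : QChain.gaugeAlg G →ₗ[ℂ] ℂ)
    (h : QChain.IsGeneralizedMarkovChain G E ρ φt φ) :
    ∃ s : ℝ,
      QChain.HasMeanEntropy (fun n : ℕ => QChain.localAlg d (Finset.Icc 1 (n : ℤ))) φt s ∧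
      QChain.HasMeanEntropy (fun n : ℕ => QChain.gaugeLocalAlg G n) φ s := by
  obtain ⟨s, hs⟩ := h.isFinitelyCorrelated.exists_tendsto
  have hφ := h.isFinitelyCorrelated.isState
  have hIcc : ∀ n : ℕ, Finset.Icc 1 (n : ℤ) = Finset.Ico 1 (1 + (n : ℤ)) := fun n => by
    ext i
    simp only [Finset.mem_Icc, Finset.mem_Ico]
    omega
  have hlocal : ∀ n : ℕ, QChain.localAlg d (Finset.Icc 1 (n : ℤ)) =
      (QChain.localHom d 1 n).range := fun n => by
    rw [hIcc, QChain.localAlg_eq_range]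
  have hinv : ∀ (n : ℕ) (σ : Equiv.Perm (Fin n)), QChain.localHom d 1 n (QChain.permOp d σ) ∈
      QChain.invariantAlg G (Finset.Icc 1 (n : ℤ)) := fun n σ => by
    rw [hIcc]
    exact QChain.localHom_permOp_mem_invariantAlg G 1 σ
  refine ⟨s, ?_, ?_⟩
  -- The full local algebras also contain the permutations, so the same comparison covers every
  -- choice of their block decompositions without a separate invariance argument.
  · exact QChain.hasMeanEntropy_of_permOp_mem hφ (StarAlgHom.id ℂ _) Function.injective_id _
      (fun n b hb => hlocal n ▸ hb) (fun n σ => ⟨_, hlocal n ▸ ⟨_, rfl⟩, rfl⟩) φt (fun _ => rfl) hs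
  · refine QChain.hasMeanEntropy_of_permOp_mem hφ (QChain.gaugeAlg G).subtype
      Subtype.val_injective _ (fun n b hb => ?_) (fun n σ => ?_) φ h.eq_restrict hs
    · rw [← hlocal]
      exact (StarSubalgebra.mem_inf.1 hb).1
    · exact ⟨⟨_, QChain.invariantAlg_le_gaugeAlg G n (hinv n σ)⟩, hinv n σ, rfl⟩
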